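/- **Setting.** Let $\mathcal X$ and $\mathcal Y(\mathbf x)\neq\emptyset$, $\mathbf x\in\mathcal X$, be finite, let $\boldsymbol\xi\sim F$ be a random scenario with values in $\Xi$, and consider $\min_{\mathbf x\in\mathcal X}G(\mathbf x)$, $G(\mathbf x)=c_0(\mathbf x)+\mathrm E_{\boldsymbol\xi}\big[\min_{\mathbf y\in\mathcal Y(\mathbf x)}q_{\mathbf x}(\mathbf y,\boldsymbol\xi)\big]$, with optimal solution $\mathbf x^\star$. Let $R_{\mathbf x,\phi}$ (on $\mathcal Y(\mathbf x)\times\Xi$) and $r_\psi$ (on $\mathcal X$) be families of strictly positive definite correlation functions with unit diagonal. For a finite nonempty design set with correlation matrix $R$, outputs $Q$, and correlation vector $R(z)$, the local metamodel with parameters $(\sigma^2,\phi)$ has posterior mean $\hat q(z)=\hat\beta+R(z)^\top R^{-1}(Q-\hat\beta\mathbf 1)$, $\hat\beta=\frac{\mathbf 1^\top R^{-1}Q}{\mathbf 1^\top R^{-1}\mathbf 1}$, and covariance $s^2(z,z')=\sigma^2\{R(z,z')-R(z)^\top R^{-1}R(z')+(1-\mathbf 1^\top R^{-1}R(z))(\mathbf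 1^\top R^{-1}\mathbf 1)^{-1}(1-\mathbf 1^\top R^{-1}R(z'))\}$; the global metamodel is the analogous one with covariance $\tau^2r_\psi$ and with a diagonal noise covariance $V$ added to the covariance matrix of the design points. **Algorithm.** Constants: $n_0,s,B\ge1$, $T\ge2$, $g>1$, $\alpha_0>0$, $\sigma_{\min}^2>0$. The set $D^{(1)}$ is a nonempty initial design in $\mathcal X$. In iteration $k=1,2,\dots$, for each $\mathbf x\in D^{(k)}$, visited for the $t$-th time: (i) the scenarios at $\mathbf x$ are increased to $N=\lceil n_0g^{t-1}\rceil$ by new i.i.d. draws from $F$, and the threshold is $\alpha=\alpha_0g^{-(t-1)/2}$; the local metamodel at $\mathbf x$, with parameter estimates $(\hat\sigma^2,\hat\phi)$ computed for this visit, is based on the points simulated so far at $\mathbf x$ (at the first visit, a nonempty finite initial design). (ii) For each new scenario $\boldsymbol\xi_j$, the current solution $\hat{\mathbf y}_j$ is a minimizer of $\hat q(\cdot,\boldsymbol\xi_j)$. (iii) As long as some scenario is not terminated, one takes such a scenario $\boldsymbol\xi_j$ and a point $\mathbf y$ that maximizes the expected improvement $EI=\mathrm E[\max(q_{\mathbf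 x}(\hat{\mathbf y}_j,\boldsymbol\xi_j)-\tilde q,0)]$, $\tilde q\sim N(\hat q(\mathbf y,\boldsymbol\xi_j),s^2)$, where $s^2$ is the posterior variance at $(\mathbf y,\boldsymbol\xi_j)$; if $EI\le\alpha|q_{\mathbf x}(\hat{\mathbf y}_j,\boldsymbol\xi_j)|$, the scenario is terminated, otherwise $(\mathbf y,\boldsymbol\xi_j)$ is simulated, added to the design set of the local metamodel, and replaces $\hat{\mathbf y}_j$ if it is better. (iv) With $B$ independent posterior sample paths $\tilde q^{(b)}$ of the resulting local metamodel, $\hat\delta_j=\frac1B\sum_b\max\big(0,q_{\mathbf x}(\hat{\mathbf y}_j,\boldsymbol\xi_j)-\min_{\mathbf y}\tilde q^{(b)}(\mathbf y,\boldsymbol\xi_j)\big)$ and $\bar G(\mathbf x)=c_0(\mathbf x)+\frac1N\sum_{j\le N}\{q_{\mathbf x}(\hat{\mathbf y}_j,\boldsymbol\xi_j)-\hat\delta_j\}$; the variance $V_{\mathbf x}$ of $\bar G(\mathbf x)$ is estimated as the sample variance of $T$ bootstrap means. For points outside $D^{(k)}$ nothing changes. Then $\hat{\mathbf x}^{\star(k)}$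 is a minimizer of $\bar G$ over the set $\mathcal S^{(k)}$ of all points visited so far; the global metamodel with estimates $(\hat\tau^2,\hat\psi)$ is fitted to $\bar G$ and $V$ on $\mathcal S^{(k)}$, its posterior variance being replaced by $\sigma_{\min}^2$ at visited points where it is smaller; and $D^{(k+1)}$ consists of $s$ independent draws from $f^{(k+1)}(\mathbf x)\propto\Pr\{\tilde G(\mathbf x)<\bar G(\hat{\mathbf x}^{\star(k)})\}$, where $\tilde G(\mathbf x)$ has the posterior distribution. With simulation budget $C$, the procedure stops at the end of the first iteration by which the number of simulation runs (design points of the local metamodels, and one run at the initial solution $\hat{\mathbf y}_j$ of every scenario) is at least $C$. **Theorem.** Assume: 1. the response $c_0(\mathbf x)+q_{\mathbf x}(\mathbf y,\boldsymbol\xi)$ is bounded, and there is a bound $\overline M$ such that, for all $\mathbf x$ and all $\phi$ in a neighbourhood of the limit parameter $\phi_{\mathbf x}$ in 4, $q_{\mathbf x}$ belongs to the reproducing kernel Hilbert space of $R_{\mathbf x,\phi}$ with norm at most $\overline M$; 2. $\mathcal X$ and all $\mathcal Y(\mathbf x)$ are finite; 3. the spatial variances $\sigma^2_{\mathbf x}$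 and $\tau^2$ are strictly positive; 4. the parameter estimates used by the algorithm (e.g. the maximum likelihood estimates) are consistent: w.p.1, $(\hat\sigma^2,\hat\phi)\to(\sigma_{\mathbf x}^2,\phi_{\mathbf x})$ along the iterations that visit $\mathbf x$, for every $\mathbf x$, and $(\hat\tau^2,\hat\psi)\to(\tau^2,\psi_0)$ as $k\to\infty$, where $\psi\mapsto r_\psi(\mathbf x,\mathbf x')$ is continuous at $\psi_0$. Then $\bar G(\hat{\mathbf x}^{\star(k)})\to G(\mathbf x^\star)$ w.p.1 as the iteration $k\to\infty$, and the value $\bar G(\hat{\mathbf x}^{\star(k)})$ reported when the budget $C$ is exhausted converges to $G(\mathbf x^\star)$ w.p.1 as $C\to\infty$. -/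

import Mathlib

open MeasureTheory ProbabilityTheory Filter Topology Matrix
open scoped Classical

universe u v w

namespace TwoStage

noncomputable section

/-! ### Correlation functions and reproducing kernel Hilbert spaces -/

/-- A (strictly positive definite) correlation function: unit diagonal, and every correlation
matrix of finitely many distinct points is symmetric positive definite. -/
def IsCorrelation {Z : Type*} (R : Z → Z → ℝ) : Prop :=
  (∀ z, R z z = 1) ∧ (Matrix.of R).PosDef

/-- `f` lies in the reproducing kernel Hilbert space on `Z` with kernel `R`, with norm `≤ M`. -/
def RKHSNormLE {Z : Type u} (R : Z → Z → ℝ) (f : Z → ℝ) (M : ℝ) : Prop :=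
  ∃ (H : Type u) (_ : NormedAddCommGroup H) (_ : InnerProductSpace ℝ H) (_ : CompleteSpace H)
    (_ : RKHS ℝ H Z ℝ), (∀ z z' : Z, RKHS.kernel H z z' 1 = R z z') ∧
      ∃ h : H, (∀ z, h z = f z) ∧ ‖h‖ ≤ M

/-! ### Gaussian process prediction with unknown constant trend

`k` is the covariance (or correlation) function, `v` the variance of the observation noise (zero
for a deterministic response), `P` the finite set of design points, `f` the observed responses. -/

/-- Covariance matrix of the observations at the design points, i.e. `Σ + V`. -/
def krigMatrix {Z : Type*} (k : Z → Z → ℝ) (v : Z → ℝ) (P : Finset Z) : Matrix P P ℝ :=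
  Matrix.of (fun i j : P => k i j) + Matrix.diagonal (fun i : P => v i)

/-- Covariances between the design points and a prediction point. -/
def krigVec {Z : Type*} (k : Z → Z → ℝ) (P : Finset Z) (z : Z) : P → ℝ := fun i => k i z

/-- The scalar `1ᵀ (Σ + V)⁻¹ 1`. -/
def krigOnes {Z : Type*} (k : Z → Z → ℝ) (v : Z → ℝ) (P : Finset Z) : ℝ :=
  (fun _ : P => (1 : ℝ)) ⬝ᵥ ((krigMatrix k v P)⁻¹ *ᵥ fun _ : P => (1 : ℝ))

/-- The generalized least squares estimate of the constant trend. -/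
def krigTrend {Z : Type*} (k : Z → Z → ℝ) (v : Z → ℝ) (P : Finset Z) (f : Z → ℝ) : ℝ :=
  (krigOnes k v P)⁻¹ *
    ((fun _ : P => (1 : ℝ)) ⬝ᵥ ((krigMatrix k v P)⁻¹ *ᵥ fun i : P => f i))

/-- The posterior mean. -/
def krigMean {Z : Type*} (k : Z → Z → ℝ) (v : Z → ℝ) (P : Finset Z) (f : Z → ℝ) (z : Z) : ℝ :=
  krigTrend k v P f +
    krigVec k P z ⬝ᵥ ((krigMatrix k v P)⁻¹ *ᵥ fun i : P => f i - krigTrend k v P f)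

/-- The scalar `η(z) = 1 - 1ᵀ (Σ + V)⁻¹ Σ(z, ·)`. -/
def krigEta {Z : Type*} (k : Z → Z → ℝ) (v : Z → ℝ) (P : Finset Z) (z : Z) : ℝ :=
  1 - (fun _ : P => (1 : ℝ)) ⬝ᵥ ((krigMatrix k v P)⁻¹ *ᵥ krigVec k P z)

/-- The posterior covariance, including the contribution of the estimated trend. -/
def krigCov {Z : Type*} (k : Z → Z → ℝ) (v : Z → ℝ) (P : Finset Z) (z z' : Z) : ℝ :=
  k z z' - krigVec k P z ⬝ᵥ ((krigMatrix k v P)⁻¹ *ᵥ krigVec k P z') +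
    krigEta k v P z * (krigOnes k v P)⁻¹ * krigEta k v P z'

/-- Expected improvement over the value `best` of a `N(m, s2)` response: `E[max(best - W, 0)]`. -/
def expImprovement (best m s2 : ℝ) : ℝ :=
  ∫ t, max (best - t) 0 ∂(gaussianReal m s2.toNNReal)

/-! ### The two-stage problem -/

/-- A two-stage problem: first-stage decisions `x : X`, second-stage decisions `y : Y x`,
scenarios `ξ : Ξ` with law `F`, costs `c0 x` and `q x (y, ξ)`. -/
structure Problem (X : Type*) (Y : X → Type*) (Ξ : Type*) [MeasurableSpace Ξ] where
  c0 : X → ℝ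
  q : (x : X) → Y x × Ξ → ℝ
  F : Measure Ξ

/-- `G(x) = c₀(x) + E_ξ [min_y q(x, y, ξ)]`. -/
def Problem.G {X : Type*} {Y : X → Type*} {Ξ : Type*} [MeasurableSpace Ξ] (p : Problem X Y Ξ)
    (x : X) : ℝ :=
  p.c0 x + ∫ ξ, (⨅ y : Y x, p.q x (y, ξ)) ∂p.F

/-! ### Constants of the algorithm -/

/-- User-chosen constants. -/
structure Params where
  /-- number of scenarios at the first visit -/
  n0 : ℕ
  /-- growth factor -/
  g : ℝ
  /-- relative expected improvement threshold at the first visit -/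
  α0 : ℝ
  /-- number of first-stage points drawn per iteration -/
  s : ℕ
  /-- number of posterior sample paths in the estimate of the optimality gap -/
  B : ℕ
  /-- number of bootstrap samples -/
  T : ℕ
  /-- lower bound imposed on the posterior variance at visited first-stage points -/
  σmin2 : ℝ
  n0_pos : 0 < n0
  one_lt_g : 1 < g
  α0_pos : 0 < α0
  s_pos : 0 < s
  B_pos : 0 < B
  two_le_T : 2 ≤ T
  σmin2_pos : 0 < σmin2

/-- Accumulated number of scenarios after `t` visits: `⌈n₀ g ^ (t - 1)⌉` (and none for `t = 0`). -/
def Params.numScen (a : Params) (t : ℕ) : ℕ :=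
  if t = 0 then 0 else ⌈(a.n0 : ℝ) * a.g ^ (t - 1)⌉₊

/-- Relative expected improvement threshold in the `t`-th visit: `α₀ g ^ (-(t - 1) / 2)`. -/
def Params.threshold (a : Params) (t : ℕ) : ℝ :=
  a.α0 * a.g ^ (-((t : ℝ) - 1) / 2)

/-! ### Second-stage search at one first-stage point -/

/-- State of the search: simulated design points, current solution for each scenario, and the set
of (indices of) terminated scenarios. -/
structure SearchState (Y Ξ : Type*) where
  design : Finset (Y × Ξ)
  best : ℕ → Y
  done : Finset ℕ

/-- Expected improvement at decision `y` for scenario `j`; `mean P` and `cov P` are the posterior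
mean and covariance of the local metamodel with design set `P`. -/
def SearchState.ei {Y Ξ : Type*} (q : Y × Ξ → ℝ) (mean : Finset (Y × Ξ) → Y × Ξ → ℝ)
    (cov : Finset (Y × Ξ) → Y × Ξ → Y × Ξ → ℝ) (ξ : ℕ → Ξ) (st : SearchState Y Ξ) (j : ℕ)
    (y : Y) : ℝ :=
  expImprovement (q (st.best j, ξ j)) (mean st.design (y, ξ j))
    (cov st.design (y, ξ j) (y, ξ j))

/-- One elementary step for a scenario `j` among the first `N` that is not terminated yet. A point
`y` of maximal expected improvement is found. If the expected improvement relative to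
`|q (ŷ_j, ξ_j)|` is at most `α`, the scenario is terminated; otherwise `(y, ξ_j)` is simulated and
added to the design set, and `y` becomes the current solution if it is better. The scenarios may be
treated in any order, in particular cyclically. -/
inductive SearchStep {Y Ξ : Type*} (q : Y × Ξ → ℝ) (mean : Finset (Y × Ξ) → Y × Ξ → ℝ)
    (cov : Finset (Y × Ξ) → Y × Ξ → Y × Ξ → ℝ) (ξ : ℕ → Ξ) (N : ℕ) (α : ℝ) :
    SearchState Y Ξ → SearchState Y Ξ → Prop
  | terminate (st : SearchState Y Ξ) (j : ℕ) (y : Y) (hj : j < N) (hnot : j ∉ st.done)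
      (hmax : ∀ y', st.ei q mean cov ξ j y' ≤ st.ei q mean cov ξ j y)
      (hle : st.ei q mean cov ξ j y ≤ α * |q (st.best j, ξ j)|) :
      SearchStep q mean cov ξ N α st
        { design := st.design, best := st.best, done := insert j st.done }
  | simulate (st : SearchState Y Ξ) (j : ℕ) (y : Y) (hj : j < N) (hnot : j ∉ st.done)
      (hmax : ∀ y', st.ei q mean cov ξ j y' ≤ st.ei q mean cov ξ j y)
      (hlt : α * |q (st.best j, ξ j)| < st.ei q mean cov ξ j y) :
      SearchStep q mean cov ξ N α st
        { design := insert (y, ξ j) st.design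
          best := Function.update st.best j
            (if q (y, ξ j) < q (st.best j, ξ j) then y else st.best j)
          done := st.done }

/-! ### Executions of the algorithm -/

/-- All quantities occurring in an execution, as functions of the outcome `ω : Ω`. Iterations are
numbered `k = 0, 1, 2, …`. The parameter estimates (in practice maximum likelihood estimates) may
be any estimates that are recomputed from iteration to iteration. `R x φ` is the local correlation function at `x` with parameter
`φ : Φ`, and `r ψ` the global correlation function with parameter `ψ : Ψ`. -/
structure Execution {X : Type*} {Y : X → Type*} {Ξ : Type*} [MeasurableSpace Ξ]
    (p : Problem X Y Ξ) (a : Params) {Φ Ψ : Type*}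
    (R : (x : X) → Φ → Y x × Ξ → Y x × Ξ → ℝ) (r : Ψ → X → X → ℝ)
    (Ω : Type*) [mΩ : MeasurableSpace Ω] where
  /-- history up to the end of iteration `k` -/
  hist : Filtration ℕ mΩ
  /-- history in iteration `k` after the second-stage searches, just before posterior sample paths
  are drawn -/
  pre : ℕ → MeasurableSpace Ω
  /-- the `j`-th scenario generated at `x` -/
  scen : (x : X) → ℕ → Ω → Ξ
  /-- first-stage points treated in iteration `k` -/
  D : ℕ → Ω → Finset X
  /-- the `s` points drawn from the sampling distribution at the end of iteration `k` -/
  draw : ℕ → Fin a.s → Ω → X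
  /-- initial (space-filling) second-stage design set at `x` -/
  design0 : (x : X) → Ω → Finset (Y x × Ξ)
  /-- second-stage design set at `x` at the end of iteration `k` -/
  design : ℕ → (x : X) → Ω → Finset (Y x × Ξ)
  /-- current second-stage solution for the `j`-th scenario at `x` at the end of iteration `k` -/
  sol : ℕ → (x : X) → Ω → ℕ → Y x
  /-- estimated variance of the local process used at `x` in iteration `k` -/
  sigma2 : ℕ → (x : X) → Ω → ℝ
  /-- estimated local correlation parameters used at `x` in iteration `k` -/
  phi : ℕ → (x : X) → Ω → Φ
  /-- estimated variance of the global process in iteration `k` -/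
  tau2 : ℕ → Ω → ℝ
  /-- estimated global correlation parameters in iteration `k` -/
  psi : ℕ → Ω → Ψ
  /-- posterior mean at `(y, ξ_j)` in the local metamodel reached at `x` in iteration `k` -/
  pathMean : ℕ → (x : X) → Y x × ℕ → Ω → ℝ
  /-- square root `A` (`A Aᵀ` = posterior covariance matrix of the points `(y, ξ_j)`) used to draw
  the posterior sample paths -/
  root : ℕ → (x : X) → Y x × ℕ → Y x × ℕ → Ω → ℝ
  /-- standard normal variables used to draw the `b`-th posterior sample path -/
  normal : ℕ → (x : X) → Fin a.B → Y x × ℕ → Ω → ℝ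
  /-- uniform variables used for the resampling indices of the bootstrap -/
  unif : ℕ → X → Fin a.T → ℕ → Ω → unitInterval
  /-- current optimal first-stage decision at the end of iteration `k` -/
  xhat : ℕ → Ω → X

namespace Execution

variable {X : Type*} {Y : X → Type*} {Ξ : Type*} [MeasurableSpace Ξ]
  {p : Problem X Y Ξ} {a : Params} {Φ Ψ : Type*}
  {R : (x : X) → Φ → Y x × Ξ → Y x × Ξ → ℝ} {r : Ψ → X → X → ℝ}
  {Ω : Type*} [mΩ : MeasurableSpace Ω]

/-- Number of visits to `x` before iteration `k`. -/
def visitsBefore (E : Execution p a R r Ω) (k : ℕ) (x : X) (ω : Ω) : ℕ :=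
  ((Finset.range k).filter fun i => x ∈ E.D i ω).card

/-- Number of visits to `x` up to and including iteration `k`. -/
def visits (E : Execution p a R r Ω) (k : ℕ) (x : X) (ω : Ω) : ℕ := E.visitsBefore (k + 1) x ω

/-- All first-stage points visited up to and including iteration `k`. -/
def S (E : Execution p a R r Ω) (k : ℕ) (ω : Ω) : Finset X :=
  (Finset.range (k + 1)).biUnion fun i => E.D i ω

/-- Accumulated number of scenarios at `x` at the end of iteration `k`. -/
def N (E : Execution p a R r Ω) (k : ℕ) (x : X) (ω : Ω) : ℕ := a.numScen (E.visits k x ω)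

/-- Second-stage design set at `x` at the beginning of iteration `k`. -/
def startDesign (E : Execution p a R r Ω) : ℕ → (x : X) → Ω → Finset (Y x × Ξ)
  | 0, x, ω => E.design0 x ω
  | k + 1, x, ω => E.design k x ω

/-- Posterior mean of the local metamodel at `x` with design set `P`, with the parameter estimates
of iteration `k`. -/
def locMean (E : Execution p a R r Ω) (k : ℕ) (x : X) (ω : Ω) (P : Finset (Y x × Ξ))
    (z : Y x × Ξ) : ℝ :=
  krigMean (R x (E.phi k x ω)) 0 P (p.q x) z

/-- Posterior covariance of the local metamodel at `x` with design set `P`, with the parameter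
estimates of iteration `k`. -/
def locCov (E : Execution p a R r Ω) (k : ℕ) (x : X) (ω : Ω) (P : Finset (Y x × Ξ))
    (z z' : Y x × Ξ) : ℝ :=
  E.sigma2 k x ω * krigCov (R x (E.phi k x ω)) 0 P z z'

/-- Value at `(y, ξ_j)` of the `b`-th posterior sample path at `x` in iteration `k`. -/
def path [∀ x, Fintype (Y x)] (E : Execution p a R r Ω) (k : ℕ) (x : X) (b : Fin a.B)
    (l : Y x × ℕ) (ω : Ω) : ℝ :=
  E.pathMean k x l ω +
    ∑ m ∈ (Finset.univ : Finset (Y x)) ×ˢ Finset.range (E.N k x ω),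
      E.root k x l m ω * E.normal k x b m ω

/-- Estimate of the expected optimality gap of the `j`-th scenario at `x` in iteration `k`. -/
def gapEst [∀ x, Fintype (Y x)] (E : Execution p a R r Ω) (k : ℕ) (x : X) (j : ℕ) (ω : Ω) : ℝ :=
  (1 / (a.B : ℝ)) * ∑ b : Fin a.B,
    max 0 (p.q x (E.sol k x ω j, E.scen x j ω) - ⨅ y : Y x, E.path k x b (y, j) ω)

/-- Gap-adjusted output of the `j`-th scenario at `x` in iteration `k`. -/
def output [∀ x, Fintype (Y x)] (E : Execution p a R r Ω) (k : ℕ) (x : X) (j : ℕ) (ω : Ω) : ℝ :=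
  p.c0 x + p.q x (E.sol k x ω j, E.scen x j ω) - E.gapEst k x j ω

/-- Average of the outputs of all scenarios at `x`, computed in iteration `k`. -/
def average [∀ x, Fintype (Y x)] (E : Execution p a R r Ω) (k : ℕ) (x : X) (ω : Ω) : ℝ :=
  (1 / (E.N k x ω : ℝ)) * ∑ j ∈ Finset.range (E.N k x ω), E.output k x j ω

/-- The `t`-th bootstrap mean at `x` in iteration `k`: average of `N` outputs drawn with
replacement. -/
def bootMean [∀ x, Fintype (Y x)] (E : Execution p a R r Ω) (k : ℕ) (x : X) (t : Fin a.T)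
    (ω : Ω) : ℝ :=
  (1 / (E.N k x ω : ℝ)) * ∑ i ∈ Finset.range (E.N k x ω),
    E.output k x ⌊(E.N k x ω : ℝ) * (E.unif k x t i ω : ℝ)⌋₊ ω

/-- Sample variance of the bootstrap means at `x` in iteration `k`. -/
def bootVar [∀ x, Fintype (Y x)] (E : Execution p a R r Ω) (k : ℕ) (x : X) (ω : Ω) : ℝ :=
  (1 / ((a.T : ℝ) - 1)) * ∑ t : Fin a.T,
    (E.bootMean k x t ω - (1 / (a.T : ℝ)) * ∑ t' : Fin a.T, E.bootMean k x t' ω) ^ 2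

/-- The estimate of `G(x)` available at the end of iteration `k`, computed in the last visit to `x`
(the value `0` before the first visit is never used). -/
def Gbar [∀ x, Fintype (Y x)] (E : Execution p a R r Ω) : ℕ → X → Ω → ℝ
  | 0, x, ω => if x ∈ E.D 0 ω then E.average 0 x ω else 0
  | k + 1, x, ω => if x ∈ E.D (k + 1) ω then E.average (k + 1) x ω else E.Gbar k x ω

/-- The bootstrap variance of that estimate. -/
def V [∀ x, Fintype (Y x)] (E : Execution p a R r Ω) : ℕ → X → Ω → ℝ
  | 0, x, ω => if x ∈ E.D 0 ω then E.bootVar 0 x ω else 0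
  | k + 1, x, ω => if x ∈ E.D (k + 1) ω then E.bootVar (k + 1) x ω else E.V k x ω

/-- Estimated spatial covariance function of the global process. -/
def globCov (E : Execution p a R r Ω) (k : ℕ) (ω : Ω) (x x' : X) : ℝ :=
  E.tau2 k ω * r (E.psi k ω) x x'

/-- Posterior mean of the global metamodel at the end of iteration `k`. -/
def postMean [∀ x, Fintype (Y x)] (E : Execution p a R r Ω) (k : ℕ) (x : X) (ω : Ω) : ℝ :=
  krigMean (E.globCov k ω) (fun x' => E.V k x' ω) (E.S k ω) (fun x' => E.Gbar k x' ω) x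

/-- Posterior variance of the global metamodel at the end of iteration `k`, bounded below by
`σmin2` at the points that were visited. -/
def postVar [∀ x, Fintype (Y x)] (E : Execution p a R r Ω) (k : ℕ) (x : X) (ω : Ω) : ℝ :=
  if x ∈ E.S k ω then
    max (krigCov (E.globCov k ω) (fun x' => E.V k x' ω) (E.S k ω) x x) a.σmin2
  else krigCov (E.globCov k ω) (fun x' => E.V k x' ω) (E.S k ω) x x

/-- Posterior probability that `x` is better than the current optimal estimate. -/
def improveProb [∀ x, Fintype (Y x)] (E : Execution p a R r Ω) (k : ℕ) (x : X) (ω : Ω) : ℝ :=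
  (gaussianReal (E.postMean k x ω) (E.postVar k x ω).toNNReal).real
    (Set.Iio (E.Gbar k (E.xhat k ω) ω))

/-- The sampling distribution used at the end of iteration `k`. -/
def sampling [Fintype X] [∀ x, Fintype (Y x)] (E : Execution p a R r Ω) (k : ℕ) (x : X)
    (ω : Ω) : ℝ :=
  E.improveProb k x ω / ∑ x' : X, E.improveProb k x' ω

/-- The σ-algebra generated by the standard normal variables of iteration `k`. -/
abbrev normalSigma (E : Execution p a R r Ω) (k : ℕ) : MeasurableSpace Ω :=
  ⨆ (x : X) (b : Fin a.B) (m : Y x × ℕ),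
    MeasurableSpace.comap (E.normal k x b m) inferInstance

/-- The σ-algebra generated by the uniform variables of iteration `k`. -/
abbrev unifSigma (E : Execution p a R r Ω) (k : ℕ) : MeasurableSpace Ω :=
  ⨆ (x : X) (t : Fin a.T) (i : ℕ), MeasurableSpace.comap (E.unif k x t i) inferInstance

/-- Simulation effort up to the end of iteration `k`: the simulated design points, and one run at
the initial metamodel-based solution of every scenario. -/
def simRuns (E : Execution p a R r Ω) (k : ℕ) (ω : Ω) : ℕ :=
  ∑ x ∈ E.S k ω, ((E.design k x ω).card + E.N k x ω)

/-- The iteration at whose end the budget `C` is found exhausted and the procedure stops. -/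
def stopIter (E : Execution p a R r Ω) (C : ℝ) (ω : Ω) : ℕ :=
  sInf {k : ℕ | C ≤ (E.simRuns k ω : ℝ)}

/-- The rules of the algorithm. -/
structure IsRun [Fintype X] [∀ x, Fintype (Y x)] (E : Execution p a R r Ω) (μ : Measure Ω) :
    Prop where
  -- histories
  pre_le_hist : ∀ k, E.pre k ≤ E.hist k
  hist_le_pre : ∀ k, E.hist k ≤ E.pre (k + 1)
  -- scenarios are i.i.d. with law `F`
  scen_law : ∀ x j, HasLaw (E.scen x j) p.F μ
  scen_indep : iIndepFun (fun i : X × ℕ => E.scen i.1 i.2) μ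
  -- initial designs
  D_zero_nonempty : ∀ ω, (E.D 0 ω).Nonempty
  D_zero_meas : ∀ x, MeasurableSet[E.pre 0] {ω | x ∈ E.D 0 ω}
  design0_nonempty : ∀ x ω, (E.design0 x ω).Nonempty
  -- the next first-stage points: `s` independent draws from the sampling distribution
  draw_meas : ∀ k i x, MeasurableSet[E.pre (k + 1)] {ω | E.draw k i ω = x}
  draw_law : ∀ k (d : Fin a.s → X),
    μ[Set.indicator {ω | ∀ i, E.draw k i ω = d i} (fun _ => (1 : ℝ)) | E.hist k]
      =ᵐ[μ] fun ω => ∏ i, E.sampling k (d i) ω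
  D_succ : ∀ k ω, E.D (k + 1) ω = Finset.univ.image fun i => E.draw k i ω
  -- nothing changes at points that are not treated
  design_skip : ∀ k x ω, x ∉ E.D k ω → E.design k x ω = E.startDesign k x ω
  sol_skip : ∀ k x ω, x ∉ E.D (k + 1) ω → E.sol (k + 1) x ω = E.sol k x ω
  -- second-stage search at the points of iteration `k`: solutions of old scenarios are kept, those
  -- of new scenarios minimize the posterior mean, then steps are made until all have terminated
  search : ∀ k x ω, x ∈ E.D k ω → ∃ st st' : SearchState (Y x) Ξ,
    st.design = E.startDesign k x ω ∧ st.done = ∅ ∧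
    (∀ j < a.numScen (E.visitsBefore k x ω), st.best j = E.sol (k - 1) x ω j) ∧
    (∀ j, a.numScen (E.visitsBefore k x ω) ≤ j → j < E.N k x ω → ∀ y,
      E.locMean k x ω st.design (st.best j, E.scen x j ω) ≤
        E.locMean k x ω st.design (y, E.scen x j ω)) ∧
    Relation.ReflTransGen
      (SearchStep (p.q x) (E.locMean k x ω) (E.locCov k x ω) (fun j => E.scen x j ω)
        (E.N k x ω) (a.threshold (E.visits k x ω))) st st' ∧
    st'.done = Finset.range (E.N k x ω) ∧
    E.design k x ω = st'.design ∧ E.sol k x ω = st'.best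
  sigma2_nonneg : ∀ k x ω, 0 ≤ E.sigma2 k x ω
  tau2_nonneg : ∀ k ω, 0 ≤ E.tau2 k ω
  -- posterior sample paths: given the history, Gaussian with the posterior mean and covariance
  pathMean_eq : ∀ k x ω, x ∈ E.D k ω → ∀ y, ∀ j < E.N k x ω,
    E.pathMean k x (y, j) ω = E.locMean k x ω (E.design k x ω) (y, E.scen x j ω)
  root_eq : ∀ k x ω, x ∈ E.D k ω → ∀ y y', ∀ j < E.N k x ω, ∀ j' < E.N k x ω,
    ∑ m ∈ (Finset.univ : Finset (Y x)) ×ˢ Finset.range (E.N k x ω),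
        E.root k x (y, j) m ω * E.root k x (y', j') m ω =
      E.locCov k x ω (E.design k x ω) (y, E.scen x j ω) (y', E.scen x j' ω)
  pathMean_meas : ∀ k x l, Measurable[E.pre k] (E.pathMean k x l)
  root_meas : ∀ k x l m, Measurable[E.pre k] (E.root k x l m)
  normal_meas : ∀ k x b m, Measurable[E.hist k] (E.normal k x b m)
  normal_law : ∀ k x b m, HasLaw (E.normal k x b m) (gaussianReal 0 1) μ
  normal_indep : ∀ k, iIndepFun
    (fun i : (Σ x : X, Fin a.B × (Y x × ℕ)) => E.normal k i.1 i.2.1 i.2.2) μ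
  normal_indep_pre : ∀ k, Indep (E.normalSigma k) (E.pre k) μ
  -- bootstrap resampling
  unif_meas : ∀ k x t i, Measurable[E.hist k] (E.unif k x t i)
  unif_law : ∀ k x t i, HasLaw (E.unif k x t i) volume μ
  unif_indep : ∀ k, iIndepFun
    (fun i : X × Fin a.T × ℕ => E.unif k i.1 i.2.1 i.2.2) μ
  unif_indep_pre : ∀ k, Indep (E.unifSigma k) (E.pre k ⊔ E.normalSigma k) μ
  -- current optimal decision
  xhat_mem : ∀ k ω, E.xhat k ω ∈ E.S k ω
  xhat_min : ∀ k ω, ∀ x ∈ E.S k ω, E.Gbar k (E.xhat k ω) ω ≤ E.Gbar k x ω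

end Execution

end

end TwoStage

/-! Fix a first-stage point x and consider the iterations that visit it. A terminated scenario has
expected improvement at most α|q| at every y, for some design set reached during the search. The
RKHS norm bound makes this a statement about the true response: by Cauchy–Schwarz the prediction
error is at most a fixed multiple K of the posterior standard deviation s (`abs_sub_krigMean_le`).
So for the true improvement u and Z standard normal, E[max(u - K s - s Z, 0)] = O(α). Comparing
Gaussian densities under shifts (`hinge_shift_le`) reverses the sign of K at the price of a square
root: E[max(u + K s - s Z, 0)] = O(√α). This quantity dominates both u and the expected improvement
for every larger design set (`improvement_le_of_expImprovement_le`).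

Hence the true gaps at the t-th visit are O(√α_t), uniformly over the scenarios. The estimated gaps
are random, but their average is dominated, at late visits, by a variable `excess` whose mean at the
t-th visit is at most |Y(x)| times O(√α_t). Since √α_t is geometric, these means are summable and
the excess tends to zero almost surely (`tendsto_excess`). Together with the strong law for min_y q,
this gives convergence of the averages at x to G(x) along the visits (`tendsto_average`).

It remains to see that every point is visited infinitely often. The estimated global covariance
matrices converge to a positive definite one, so they are eventually bounded and uniformly positive
definite. This bounds the prediction weights whatever the noise variances are
(`exists_bounded_krigWeights`), so no limit of the bootstrap variances is needed. With bounded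
posterior means, and variances bounded below, each point keeps a sampling probability bounded away
from zero, and the conditional Borel–Cantelli lemma applies (`frequently_mem_D`).

Finally, X being finite, all estimates are eventually close to their limits simultaneously, and so
are their minima. Every budget is reached, at an iteration that tends to infinity with the budget,
which gives the second claim. -/

namespace TwoStage

/-! ### Optimal weights in Gaussian process prediction -/

/-- Mean squared error of the linear predictor with weights `w`. -/
noncomputable def predError {Z : Type*} (k : Z → Z → ℝ) (v : Z → ℝ) (P : Finset Z) (z : Z)
    (w : P → ℝ) : ℝ :=
  k z z - 2 * (w ⬝ᵥ krigVec k P z) + w ⬝ᵥ (krigMatrix k v P *ᵥ w)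

/-- Kriging with an estimated trend is best linear unbiased prediction: it minimizes the quadratic
`predError` under the constraint that the weights sum to one. Later bounds of the posterior variance
come from inserting convenient weights into this minimum property. -/
theorem exists_krigWeights {Z : Type*} (k : Z → Z → ℝ) (v : Z → ℝ) (P : Finset Z)
    (hP : P.Nonempty) (hA : (krigMatrix k v P).PosDef) (z : Z) :
    ∃ w : P → ℝ, ∑ i, w i = 1 ∧ (∀ f : Z → ℝ, krigMean k v P f z = ∑ i, w i * f i) ∧
      krigCov k v P z z = predError k v P z w ∧
      ∀ w' : P → ℝ, ∑ i, w' i = 1 → krigCov k v P z z ≤ predError k v P z w' := by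
  have : Nonempty P := hP.to_subtype
  set A := krigMatrix k v P with hAdef
  set e : P → ℝ := fun _ => 1 with he
  set c := krigVec k P z with hc
  have hAi := hA.inv
  have hsymm : ∀ x y : P → ℝ, x ⬝ᵥ (A *ᵥ y) = y ⬝ᵥ (A *ᵥ x) := by
    intro x y
    have : Aᵀ = A := by simpa [Matrix.IsHermitian] using hA.isHermitian
    rw [dotProduct_comm, dotProduct_mulVec, ← mulVec_transpose, this, dotProduct_comm,
      dotProduct_comm]
  have hsymmi : ∀ x y : P → ℝ, x ⬝ᵥ (A⁻¹ *ᵥ y) = y ⬝ᵥ (A⁻¹ *ᵥ x) := by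
    intro x y
    have : A⁻¹ᵀ = A⁻¹ := by simpa [Matrix.IsHermitian] using hAi.isHermitian
    rw [dotProduct_comm, dotProduct_mulVec, ← mulVec_transpose, this, dotProduct_comm,
      dotProduct_comm]
  have hdet : IsUnit A.det := (Matrix.isUnit_iff_isUnit_det _).1 hA.isUnit
  have hAAi : ∀ x : P → ℝ, A *ᵥ (A⁻¹ *ᵥ x) = x := by
    intro x; rw [mulVec_mulVec, mul_nonsing_inv _ hdet, one_mulVec]
  have hones : 0 < krigOnes k v P := by
    have := hAi.dotProduct_mulVec_pos (x := e) (by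
      intro h
      have := congrFun h (Classical.arbitrary P)
      simp [he] at this)
    simpa [krigOnes] using this
  have hones' : e ⬝ᵥ (A⁻¹ *ᵥ e) = krigOnes k v P := rfl
  set o := krigOnes k v P
  have heta : krigEta k v P z = 1 - e ⬝ᵥ (A⁻¹ *ᵥ c) := rfl
  set η := krigEta k v P z
  -- Lagrange multiplier of the constraint that the weights sum to one.
  set m : ℝ := η * o⁻¹ with hm
  have hmo : m * o = η := by rw [hm]; field_simp
  let w : P → ℝ := A⁻¹ *ᵥ (c + m • e)
  have hAw : A *ᵥ w = c + m • e := hAAi _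
  have hesum : ∀ x : P → ℝ, x ⬝ᵥ e = ∑ i, x i := by intro x; simp [dotProduct, he]
  have hsum : w ⬝ᵥ e = 1 := by
    rw [dotProduct_comm]
    simp only [w, mulVec_add, dotProduct_add, mulVec_smul, dotProduct_smul, smul_eq_mul]
    rw [hones', hmo, heta]; ring
  have hcov : krigCov k v P z z = predError k v P z w := by
    have h1 : krigCov k v P z z = k z z - c ⬝ᵥ (A⁻¹ *ᵥ c) + η * o⁻¹ * η := rfl
    have h2 : c ⬝ᵥ w = c ⬝ᵥ (A⁻¹ *ᵥ c) + m * (1 - η) := by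
      simp only [w, mulVec_add, dotProduct_add, mulVec_smul, dotProduct_smul, smul_eq_mul]
      rw [hsymmi c e, heta]; ring
    rw [h1, predError, ← hAdef, hAw, dotProduct_add, dotProduct_smul, hsum, dotProduct_comm w, h2]
    simp only [smul_eq_mul]
    rw [← hm]; ring
  refine ⟨w, by rw [← hesum, hsum], ?_, hcov, ?_⟩
  · intro f
    set F : P → ℝ := fun i => f i
    have h1 : krigTrend k v P f = o⁻¹ * (e ⬝ᵥ (A⁻¹ *ᵥ F)) := rfl
    set β := krigTrend k v P f with hβ
    have h2 : krigMean k v P f z = β + c ⬝ᵥ (A⁻¹ *ᵥ (F - β • e)) := by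
      have : (F - β • e) = fun i : P => f i - β := by ext i; simp [F, he]
      rw [this]; rfl
    have h3 : ∑ i, w i * f i = F ⬝ᵥ w := by rw [dotProduct_comm]; rfl
    rw [h2, h3]
    simp only [w, mulVec_add, mulVec_sub, dotProduct_add, dotProduct_sub, mulVec_smul,
      dotProduct_smul, smul_eq_mul]
    rw [hsymmi F c, hsymmi F e, hsymmi c e]
    rw [hm, h1, heta]; field_simp; ring
  · intro w' hw'
    rw [hcov]
    rw [← hesum] at hw'
    have hd : 0 ≤ (w' - w) ⬝ᵥ (A *ᵥ (w' - w)) := by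
      simpa using hA.posSemidef.dotProduct_mulVec_nonneg (w' - w)
    -- The multiplier drops out because both weight vectors have sum one; what is left of the
    -- difference of the two errors is the quadratic form at `w' - w`.
    have hx : (w' - w) ⬝ᵥ (A *ᵥ w) = w' ⬝ᵥ c - w ⬝ᵥ c := by
      rw [hAw, sub_dotProduct, dotProduct_add, dotProduct_add, dotProduct_smul, dotProduct_smul,
        hsum, hw']; ring
    have h4 : (w' - w) ⬝ᵥ (A *ᵥ (w' - w)) = w' ⬝ᵥ (A *ᵥ w') - w ⬝ᵥ (A *ᵥ w)
        - 2 * ((w' - w) ⬝ᵥ (A *ᵥ w)) := by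
      simp only [mulVec_sub, sub_dotProduct, dotProduct_sub]
      rw [hsymm w w']; ring
    simp only [predError, ← hAdef, ← hc]
    linarith

theorem IsCorrelation.posDef_krigMatrix {Z : Type*} {R : Z → Z → ℝ} (hR : IsCorrelation R)
    {t : ℝ} (ht : 0 < t) {v : Z → ℝ} (hv : ∀ z, 0 ≤ v z) (P : Finset Z) :
    (krigMatrix (fun z z' => t * R z z') v P).PosDef := by
  have h1 : (Matrix.of (fun i j : P => R i j)).PosDef :=
    hR.2.submatrix (e := fun i : P => (i : Z)) Subtype.val_injective
  have h2 : (t • Matrix.of (fun i j : P => R i j)).PosDef := h1.smul ht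
  have h3 : (Matrix.diagonal (fun i : P => v i)).PosSemidef :=
    Matrix.PosSemidef.diagonal (fun i => hv i)
  exact h2.add_posSemidef h3

theorem IsCorrelation.symm {Z : Type*} {R : Z → Z → ℝ} (hR : IsCorrelation R) (z z' : Z) :
    R z z' = R z' z := by
  simpa using (hR.2.isHermitian.apply z z').symm

theorem predError_eq {Z : Type*} (k : Z → Z → ℝ) (v : Z → ℝ) (P : Finset Z) (z : Z)
    (w : P → ℝ) :
    predError k v P z w = k z z - 2 * ∑ i, w i * k i z + ∑ i, ∑ j, w i * w j * k i j +
      ∑ i, w i ^ 2 * v i := by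
  simp only [predError, krigMatrix, add_mulVec, dotProduct_add]
  have h1 : w ⬝ᵥ (Matrix.of (fun i j : P => k i j) *ᵥ w) = ∑ i, ∑ j, w i * w j * k i j := by
    simp only [dotProduct, mulVec, Finset.mul_sum, Matrix.of_apply]
    refine Finset.sum_congr rfl fun i _ => Finset.sum_congr rfl fun j _ => by ring
  have h2 : w ⬝ᵥ (Matrix.diagonal (fun i : P => v i) *ᵥ w) = ∑ i, w i ^ 2 * v i := by
    simp only [dotProduct, mulVec_diagonal]
    refine Finset.sum_congr rfl fun i _ => by ring
  rw [h1, h2]; simp only [dotProduct, krigVec]; ring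

/-! ### Deterministic responses -/

theorem IsCorrelation.posDef_krigMatrix_zero {Z : Type*} {R : Z → Z → ℝ} (hR : IsCorrelation R)
    (P : Finset Z) : (krigMatrix R 0 P).PosDef := by
  simpa using hR.posDef_krigMatrix one_pos (v := 0) (fun _ => le_rfl) P

/-- Without noise the prediction problem is geometric: the error is a squared distance between
feature vectors in a Hilbert space. -/
theorem predError_zero_eq_norm_sq {Z : Type*} {R : Z → Z → ℝ} {H : Type*} [NormedAddCommGroup H]
    [InnerProductSpace ℝ H] (e : Z → H) (he : ∀ z z', inner ℝ (e z) (e z') = R z z')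
    (P : Finset Z) (z : Z) (w : P → ℝ) :
    predError R 0 P z w = ‖e z - ∑ i, w i • e i‖ ^ 2 := by
  rw [predError_eq, norm_sub_sq_real, ← real_inner_self_eq_norm_sq, ← real_inner_self_eq_norm_sq]
  simp only [sum_inner, inner_sum, inner_smul_left, inner_smul_right, he]
  have hsymm : ∀ y y', R y y' = R y' y := fun y y' => by rw [← he, ← he, real_inner_comm]
  simp only [Pi.zero_apply, mul_zero, Finset.sum_const_zero, add_zero, conj_trivial, hsymm z,
    Finset.mul_sum]
  congr 1
  refine Finset.sum_congr rfl fun i _ => Finset.sum_congr rfl fun j _ => ?_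
  rw [hsymm i j]; ring

theorem RKHSNormLE.exists_feature {Z : Type u} {R : Z → Z → ℝ} {f : Z → ℝ} {M : ℝ}
    (h : RKHSNormLE R f M) : ∃ (H : Type u) (_ : NormedAddCommGroup H)
      (_ : InnerProductSpace ℝ H) (e : Z → H) (g : H), (∀ z z', inner ℝ (e z) (e z') = R z z') ∧
      (∀ z, inner ℝ (e z) g = f z) ∧ ‖g‖ ≤ M := by
  obtain ⟨H, i1, i2, i3, i4, hk, g, hg, hM⟩ := h
  refine ⟨H, i1, i2, fun z => RKHS.kerFun H z 1, g, fun z z' => ?_, fun z => ?_, hM⟩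
  · rw [RKHS.kerFun_inner, RKHS.kerFun_apply, hk]; simp
  · rw [RKHS.kerFun_inner, hg]; simp

/-- By the reproducing property the error is the inner product of the representer of `f` with the
residual feature vector, whose norm is the posterior standard deviation; apply Cauchy–Schwarz. -/
theorem abs_sub_krigMean_le {Z : Type*} {R : Z → Z → ℝ} (hR : IsCorrelation R) {f : Z → ℝ} {M : ℝ}
    (hf : RKHSNormLE R f M) {P : Finset Z} (hP : P.Nonempty) (z : Z) :
    |f z - krigMean R 0 P f z| ≤ M * √(krigCov R 0 P z z) := by
  obtain ⟨w, -, hmean, hcov, -⟩ := exists_krigWeights R 0 P hP (hR.posDef_krigMatrix_zero P) z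
  obtain ⟨H, _, _, e, g, he, hg, hM⟩ := hf.exists_feature
  rw [hmean, hcov, predError_zero_eq_norm_sq e he, Real.sqrt_sq (norm_nonneg _)]
  have : f z - ∑ i, w i * f i = inner ℝ (e z - ∑ i, w i • e i) g := by
    simp [inner_sub_left, sum_inner, inner_smul_left, hg]
  rw [this]
  calc _ ≤ ‖e z - ∑ i, w i • e i‖ * ‖g‖ := abs_real_inner_le_norm _ _
    _ ≤ ‖e z - ∑ i, w i • e i‖ * M := by gcongr
    _ = _ := mul_comm _ _

theorem RKHSNormLE.krigCov_nonneg {Z : Type*} {R : Z → Z → ℝ} (hR : IsCorrelation R) {f : Z → ℝ}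
    {M : ℝ} (hf : RKHSNormLE R f M) {P : Finset Z} (hP : P.Nonempty) (z : Z) :
    0 ≤ krigCov R 0 P z z := by
  obtain ⟨w, -, -, hcov, -⟩ := exists_krigWeights R 0 P hP (hR.posDef_krigMatrix_zero P) z
  obtain ⟨H, _, _, e, g, he, hg, hM⟩ := hf.exists_feature
  rw [hcov, predError_zero_eq_norm_sq e he]; positivity

/-- Compare with the predictor that puts all weight on one design point: two unit feature vectors
are at distance at most 2. -/
theorem RKHSNormLE.krigCov_le_four {Z : Type*} {R : Z → Z → ℝ} (hR : IsCorrelation R) {f : Z → ℝ}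
    {M : ℝ} (hf : RKHSNormLE R f M) {P : Finset Z} (hP : P.Nonempty) (z : Z) :
    krigCov R 0 P z z ≤ 4 := by
  obtain ⟨w, -, -, -, hmin⟩ := exists_krigWeights R 0 P hP (hR.posDef_krigMatrix_zero P) z
  obtain ⟨H, _, _, e, g, he, hg, hM⟩ := hf.exists_feature
  obtain ⟨z0, hz0⟩ := hP
  refine (hmin (Pi.single ⟨z0, hz0⟩ 1) (by simp)).trans ?_
  rw [predError_zero_eq_norm_sq e he, Finset.sum_eq_single ⟨z0, hz0⟩ (by
    intro b _ hb; simp [hb]) (by simp)]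
  have hn : ∀ z, ‖e z‖ = 1 := by
    intro z
    have : ‖e z‖ ^ 2 = 1 := by rw [← real_inner_self_eq_norm_sq, he, hR.1]
    exact (pow_eq_one_iff_of_nonneg (norm_nonneg _) two_ne_zero).1 this
  have : ‖e z - (Pi.single (⟨z0, hz0⟩ : P) (1 : ℝ) : P → ℝ) ⟨z0, hz0⟩ • e z0‖ ≤ 2 := by
    refine (norm_sub_le _ _).trans ?_
    rw [norm_smul, hn, hn]; simp; norm_num
  nlinarith [norm_nonneg (e z - (Pi.single (⟨z0, hz0⟩ : P) (1 : ℝ) : P → ℝ) ⟨z0, hz0⟩ • e z0)]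

/-- Optimal weights for the smaller design, extended by zero, are admissible for the larger one. -/
theorem krigCov_anti {Z : Type u} {R : Z → Z → ℝ} (hR : IsCorrelation R) {f : Z → ℝ}
    {M : ℝ} (hf : RKHSNormLE R f M) {P P' : Finset Z} (hP : P.Nonempty) (hPP : P ⊆ P') (z : Z) :
    krigCov R 0 P' z z ≤ krigCov R 0 P z z := by
  obtain ⟨w, hsum, -, hcov, -⟩ := exists_krigWeights R 0 P hP (hR.posDef_krigMatrix_zero P) z
  obtain ⟨-, -, -, -, hmin⟩ :=
    exists_krigWeights R 0 P' (hP.mono hPP) (hR.posDef_krigMatrix_zero P') z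
  obtain ⟨H, _, _, e, g, he, hg, hM⟩ := hf.exists_feature
  let u : Z → ℝ := fun y => if hy : y ∈ P then w ⟨y, hy⟩ else 0
  have key : ∀ {E : Type u} [AddCommGroup E] [Module ℝ E] (c : Z → E),
      ∑ i : P', u i • c i = ∑ i : P, w i • c i := by
    intro E _ _ c
    rw [Finset.sum_coe_sort P' (fun y => u y • c y)]
    rw [← Finset.sum_subset hPP (by intro y _ hy; simp [u, hy])]
    rw [← Finset.sum_coe_sort P (fun y => u y • c y)]
    refine Finset.sum_congr rfl fun i _ => ?_
    simp [u]
  have h1 := hmin (fun i => u i) (by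
    -- `key` ranges over modules in universe `u`, to serve the feature space; the scalar sum
    -- therefore passes through `ULift ℝ`.
    have := key (fun _ => (ULift.up 1 : ULift.{u} ℝ))
    have := congrArg (ULift.moduleEquiv (R := ℝ)) this
    simp only [map_sum, map_smul, ULift.moduleEquiv_apply, smul_eq_mul, mul_one] at this
    rw [this, hsum])
  rw [hcov, predError_zero_eq_norm_sq e he, ← key e]
  rwa [predError_zero_eq_norm_sq e he] at h1

/-! ### Expected improvement as a function of the standardized parameters -/

/-- `E[max(u - s Z, 0)]` for a standard normal variable `Z`. -/
noncomputable def hinge (u s : ℝ) : ℝ := ∫ t, max (u - s * t) 0 ∂(gaussianReal 0 1)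

theorem integrable_hinge (u s : ℝ) :
    Integrable (fun t : ℝ => max (u - s * t) 0) (gaussianReal 0 1) := by
  have h : Integrable (fun t : ℝ => t) (gaussianReal 0 1) :=
    (memLp_id_gaussianReal (μ := 0) (v := 1) 1).integrable le_rfl
  exact ((integrable_const u).sub (h.const_mul s)).pos_part

/-- No sign condition on `v` is needed: `toNNReal` and `√` both truncate negative values to zero. -/
theorem gaussianReal_eq_map (m v : ℝ) :
    gaussianReal m v.toNNReal = (gaussianReal 0 1).map (fun t => m + √v * t) := by
  have h1 := gaussianReal_map_const_mul (μ := 0) (v := 1) (√v)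
  have h2 := gaussianReal_map_const_add (μ := 0) (v := v.toNNReal) m
  have h3 : (NNReal.mk ((√v) ^ 2) (sq_nonneg _)) * 1 = v.toNNReal := by
    ext
    rcases le_total 0 v with h | h
    · simp [Real.sq_sqrt h, h]
    · simp [Real.sqrt_eq_zero_of_nonpos h, h]
  rw [mul_zero, h3] at h1
  rw [zero_add, ← h1, Measure.map_map (by fun_prop) (by fun_prop)] at h2
  exact h2.symm

theorem expImprovement_eq_hinge (b m v : ℝ) : expImprovement b m v = hinge (b - m) √v := by
  rw [expImprovement, gaussianReal_eq_map, integral_map (by fun_prop) (by fun_prop), hinge]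
  refine integral_congr_ae (ae_of_all _ fun t => ?_)
  simp only [sub_sub]

theorem hinge_nonneg (u s : ℝ) : 0 ≤ hinge u s := integral_nonneg fun _ => le_max_right _ _

theorem hinge_mono_left {u u' : ℝ} (h : u ≤ u') (s : ℝ) : hinge u s ≤ hinge u' s :=
  integral_mono (integrable_hinge _ _) (integrable_hinge _ _) fun t =>
    max_le_max (by linarith) le_rfl

theorem le_hinge (u s : ℝ) : u ≤ hinge u s := by
  have h : Integrable (fun t : ℝ => t) (gaussianReal 0 1) :=
    (memLp_id_gaussianReal (μ := 0) (v := 1) 1).integrable le_rfl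
  have h1 : ∫ t, (u - s * t) ∂(gaussianReal 0 1) = u := by
    rw [integral_sub (integrable_const u) (h.const_mul s), integral_const_mul,
      integral_id_gaussianReal]
    simp
  calc u = ∫ t, (u - s * t) ∂(gaussianReal 0 1) := h1.symm
    _ ≤ hinge u s := integral_mono ((integrable_const u).sub (h.const_mul s))
        (integrable_hinge _ _) fun t => le_max_left _ _

/-- The expected improvement increases with the standard deviation, also if the mean moves in
favour of an improvement by a multiple of the standard deviation. -/
theorem hinge_add_mul_mono {K : ℝ} (hK : 0 ≤ K) (u : ℝ) {s s' : ℝ} (hs : 0 ≤ s) (hss : s ≤ s') :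
    hinge (u + K * s) s ≤ hinge (u + K * s') s' := by
  rcases hss.eq_or_lt with rfl | hlt
  · exact le_rfl
  have hs' : 0 < s' := hs.trans_lt hlt
  set θ := s / s' with hθ
  have hθ0 : 0 ≤ θ := by positivity
  have hθ1 : θ ≤ 1 := (div_le_one hs').2 hss
  have hsθ : s = θ * s' := by rw [hθ]; field_simp
  -- The argument at scale `s` is the convex combination of its values at scales 0 and `s'` with
  -- weight `θ = s / s'`, and the positive part is convex.
  have h1 : hinge (u + K * s) s ≤ (1 - θ) * max u 0 + θ * hinge (u + K * s') s' := by
    rw [hinge, hinge, ← integral_const_mul]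
    have : (1 - θ) * max u 0 = ∫ _, (1 - θ) * max u 0 ∂(gaussianReal 0 1) := by simp
    rw [this, ← integral_add (integrable_const _) ((integrable_hinge _ _).const_mul _)]
    refine integral_mono (integrable_hinge _ _)
      ((integrable_const _).add ((integrable_hinge _ _).const_mul _)) fun t => ?_
    refine max_le ?_ (add_nonneg (mul_nonneg (by linarith) (le_max_right _ _))
      (mul_nonneg hθ0 (le_max_right _ _)))
    have e : u + K * s - s * t = (1 - θ) * u + θ * (u + K * s' - s' * t) := by rw [hsθ]; ring
    rw [e]
    exact add_le_add (mul_le_mul_of_nonneg_left (le_max_left _ _) (by linarith))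
      (mul_le_mul_of_nonneg_left (le_max_left _ _) hθ0)
  have h2 : max u 0 ≤ hinge (u + K * s') s' := by
    refine max_le (le_trans ?_ (le_hinge _ _)) (hinge_nonneg _ _)
    nlinarith [mul_nonneg hK hs'.le]
  nlinarith [mul_le_mul_of_nonneg_left h2 (sub_nonneg.2 hθ1)]

theorem hinge_mono_right (u : ℝ) {s s' : ℝ} (hs : 0 ≤ s) (hss : s ≤ s') :
    hinge u s ≤ hinge u s' := by
  simpa using hinge_add_mul_mono le_rfl u hs hss

theorem integral_abs_gaussian_le : ∫ t, |t| ∂(gaussianReal 0 1) ≤ 1 := by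
  have h1 : Integrable (fun t : ℝ => t) (gaussianReal 0 1) :=
    (memLp_id_gaussianReal (μ := 0) (v := 1) 1).integrable le_rfl
  have h2 : Integrable (fun t : ℝ => t ^ 2) (gaussianReal 0 1) :=
    (memLp_id_gaussianReal (μ := 0) (v := 1) 2).integrable_sq
  have h3 : ∫ t, t ^ 2 ∂(gaussianReal 0 1) = 1 := by
    have := variance_fun_id_gaussianReal (μ := 0) (v := 1)
    rw [variance_eq_integral (by fun_prop)] at this
    simpa using this
  calc ∫ t, |t| ∂(gaussianReal 0 1) ≤ ∫ t, (1 + t ^ 2) / 2 ∂(gaussianReal 0 1) :=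
        integral_mono h1.abs (((integrable_const 1).add h2).div_const 2) fun t => by
          change |t| ≤ (1 + t ^ 2) / 2
          nlinarith [sq_nonneg (|t| - 1), sq_abs t]
    _ = 1 := by
      rw [integral_div, integral_add (integrable_const 1) h2, h3]; simp

theorem hinge_le (u : ℝ) {s : ℝ} (hs : 0 ≤ s) : hinge u s ≤ |u| + s := by
  have h1 : Integrable (fun t : ℝ => t) (gaussianReal 0 1) :=
    (memLp_id_gaussianReal (μ := 0) (v := 1) 1).integrable le_rfl
  calc hinge u s ≤ ∫ t, (|u| + s * |t|) ∂(gaussianReal 0 1) :=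
        integral_mono (integrable_hinge _ _) ((integrable_const _).add (h1.abs.const_mul s))
          fun t => max_le (by
            have h2 := le_abs_self u
            have h3 := mul_le_mul_of_nonneg_left (neg_abs_le t) hs
            change u - s * t ≤ |u| + s * |t|
            linarith) (by positivity)
    _ = |u| + s * ∫ t, |t| ∂(gaussianReal 0 1) := by
        rw [integral_add (integrable_const _) (h1.abs.const_mul s), integral_const_mul]; simp
    _ ≤ |u| + s := by nlinarith [integral_abs_gaussian_le]

/-- Pointwise from (s t + 2 L)² ≥ 0. The decay in `L` ensures that arbitrarily small expected
improvements occur, which makes `offset` meaningful. -/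
theorem hinge_neg_le {L : ℝ} (hL : 0 < L) (s : ℝ) : hinge (-L) s ≤ s ^ 2 / (4 * L) := by
  have h2 : Integrable (fun t : ℝ => t ^ 2) (gaussianReal 0 1) :=
    (memLp_id_gaussianReal (μ := 0) (v := 1) 2).integrable_sq
  have h3 : ∫ t, t ^ 2 ∂(gaussianReal 0 1) = 1 := by
    have := variance_fun_id_gaussianReal (μ := 0) (v := 1)
    rw [variance_eq_integral (by fun_prop)] at this
    simpa using this
  calc hinge (-L) s ≤ ∫ t, s ^ 2 / (4 * L) * t ^ 2 ∂(gaussianReal 0 1) :=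
        integral_mono (integrable_hinge _ _) (h2.const_mul _) fun t => by
          refine max_le ?_ (by positivity)
          change -L - s * t ≤ s ^ 2 / (4 * L) * t ^ 2
          rw [div_mul_eq_mul_div, le_div_iff₀ (by positivity)]
          nlinarith [sq_nonneg (s * t + 2 * L)]
    _ = s ^ 2 / (4 * L) := by rw [integral_const_mul, h3, mul_one]

theorem continuous_hinge_left (s : ℝ) : Continuous fun u => hinge u s := by
  refine LipschitzWith.continuous (K := 1) (LipschitzWith.of_dist_le_mul fun u u' => ?_)
  rw [NNReal.coe_one, one_mul, Real.dist_eq, Real.dist_eq, hinge, hinge,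
    ← integral_sub (integrable_hinge _ _) (integrable_hinge _ _)]
  calc _ ≤ ∫ t, |max (u - s * t) 0 - max (u' - s * t) 0| ∂(gaussianReal 0 1) :=
        abs_integral_le_integral_abs
    _ ≤ ∫ _, |u - u'| ∂(gaussianReal 0 1) := by
        refine integral_mono ((integrable_hinge _ _).sub (integrable_hinge _ _)).abs
          (integrable_const _) fun t => ?_
        have := abs_max_sub_max_le_abs (u - s * t) (u' - s * t) 0
        simpa using this
    _ = |u - u'| := by simp

/-! ### Change of measure for shifted normal variables -/

theorem integrable_gaussianPDF_mul_shift (b s c : ℝ) :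
    Integrable (fun z => gaussianPDFReal 0 1 (z + c) * max (b - s * z) 0) := by
  have h := integrable_hinge (b + c * s) s
  rw [gaussianReal_of_var_ne_zero _ one_ne_zero,
    integrable_withDensity_iff_integrable_smul' (measurable_gaussianPDF _ _)
      (ae_of_all _ fun _ => gaussianPDF_lt_top)] at h
  have h2 := h.comp_add_right c
  refine h2.congr (ae_of_all _ fun z => ?_)
  simp only [toReal_gaussianPDF, smul_eq_mul]
  congr 2; ring

/-- Translating the integration variable moves the shift by `c` standard deviations from the
integrand into the density, so that different shifts can be compared through densities alone. -/
theorem hinge_add_mul (b s c : ℝ) :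
    hinge (b + c * s) s = ∫ z, gaussianPDFReal 0 1 (z + c) * max (b - s * z) 0 := by
  rw [hinge, integral_gaussianReal_eq_integral_smul one_ne_zero]
  rw [← integral_add_right_eq_self _ c]
  refine integral_congr_ae (ae_of_all _ fun z => ?_)
  simp only [smul_eq_mul]
  congr 2; ring

/-- Up to the factor exp(4K²), the square of the density at `z + 2 * K` is the product of those at
`z` and `z + 4 * K`; the claim is the weighted arithmetic–geometric mean inequality. -/
theorem gaussianPDFReal_add_le (K : ℝ) {l : ℝ} (hl : 0 < l) (z : ℝ) :
    gaussianPDFReal 0 1 (z + 2 * K) ≤ (l * gaussianPDFReal 0 1 z +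
      l⁻¹ * Real.exp (4 * K ^ 2) * gaussianPDFReal 0 1 (z + 4 * K)) / 2 := by
  have h1 : gaussianPDFReal 0 1 (z + 2 * K) ^ 2 =
      gaussianPDFReal 0 1 z * (Real.exp (4 * K ^ 2) * gaussianPDFReal 0 1 (z + 4 * K)) := by
    simp only [gaussianPDFReal, mul_pow, ← Real.exp_nat_mul]
    have : ∀ c x y w : ℝ, c * Real.exp x * (Real.exp w * (c * Real.exp y)) =
        c ^ 2 * Real.exp (w + x + y) := by
      intro c x y w; rw [Real.exp_add, Real.exp_add]; ring
    rw [this]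
    congr 2
    push_cast
    ring
  have hA := gaussianPDFReal_nonneg 0 1 z
  have hB := gaussianPDFReal_nonneg 0 1 (z + 2 * K)
  have hC := mul_nonneg (Real.exp_pos (4 * K ^ 2)).le (gaussianPDFReal_nonneg 0 1 (z + 4 * K))
  set A := gaussianPDFReal 0 1 z
  set B := gaussianPDFReal 0 1 (z + 2 * K)
  rw [mul_assoc]
  set C := Real.exp (4 * K ^ 2) * gaussianPDFReal 0 1 (z + 4 * K)
  have h2 : l * l⁻¹ = 1 := mul_inv_cancel₀ hl.ne'
  have h3 : (2 * B) ^ 2 ≤ (l * A + l⁻¹ * C) ^ 2 := by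
    have : (l * A + l⁻¹ * C) ^ 2 - (2 * B) ^ 2 = (l * A - l⁻¹ * C) ^ 2 := by
      have : (l * A) * (l⁻¹ * C) = B ^ 2 := by rw [h1]; linear_combination (A * C) * h2
      linear_combination 4 * this
    nlinarith [sq_nonneg (l * A - l⁻¹ * C)]
  have h4 : 0 ≤ l * A + l⁻¹ * C := by positivity
  have := (sq_le_sq₀ (by positivity) h4).1 h3
  linarith

/-- This bounds the optimistic value, shifted by `+K s`, by the pessimistic one, shifted by `-K s`.
Only crude control of the term at `3 K s` is needed, since its factor `l⁻¹` can be made small. -/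
theorem hinge_shift_le (a s K : ℝ) {l : ℝ} (hl : 0 < l) :
    hinge (a + K * s) s ≤ (l * hinge (a - K * s) s +
      l⁻¹ * Real.exp (4 * K ^ 2) * hinge (a + 3 * K * s) s) / 2 := by
  have h0 := hinge_add_mul (a - K * s) s 0
  have h2 := hinge_add_mul (a - K * s) s (2 * K)
  have h4 := hinge_add_mul (a - K * s) s (4 * K)
  have i0 := integrable_gaussianPDF_mul_shift (a - K * s) s 0
  have i2 := integrable_gaussianPDF_mul_shift (a - K * s) s (2 * K)
  have i4 := integrable_gaussianPDF_mul_shift (a - K * s) s (4 * K)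
  simp only [zero_mul, add_zero] at h0 i0
  rw [show a - K * s + 2 * K * s = a + K * s by ring] at h2
  rw [show a - K * s + 4 * K * s = a + 3 * K * s by ring] at h4
  rw [h0, h2, h4, ← integral_const_mul, ← integral_const_mul,
    ← integral_add (i0.const_mul _) (i4.const_mul _), ← integral_div]
  refine integral_mono i2 (((i0.const_mul _).add (i4.const_mul _)).div_const 2) fun z => ?_
  have := mul_le_mul_of_nonneg_right (gaussianPDFReal_add_le K hl z)
    (le_max_right (a - K * s - s * z) 0)
  refine this.trans (le_of_eq ?_)
  ring

/-! ### The largest improvement with expected value at most `ε` -/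

/-- The largest `u` for which `E[max(u - W, 0)] ≤ ε` with `W ∼ N(0, v)`. -/
noncomputable def offset (ε v : ℝ) : ℝ := sSup {u | hinge u √v ≤ ε}

/-- The set is bounded above by `ε` because a mean never exceeds the mean of the positive part. This
replaces an improvement by a function of the variance alone, whose expected excess is small whether
or not the search has already become accurate. -/
theorem le_offset {ε v u : ℝ} (h : hinge u √v ≤ ε) : u ≤ offset ε v :=
  le_csSup ⟨ε, fun _ hu => (le_hinge _ _).trans hu⟩ h

theorem exists_hinge_le {ε : ℝ} (hε : 0 < ε) (v : ℝ) : ∃ u, hinge u √v ≤ ε := by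
  refine ⟨-((√v) ^ 2 / (4 * ε) + 1), (hinge_neg_le (by positivity) _).trans ?_⟩
  rw [div_le_iff₀ (by positivity)]
  field_simp
  nlinarith

theorem hinge_offset_le {ε : ℝ} (hε : 0 < ε) (v : ℝ) : hinge (offset ε v) √v ≤ ε :=
  IsClosed.csSup_mem (s := {u | hinge u √v ≤ ε})
    (isClosed_le (continuous_hinge_left _) continuous_const) (exists_hinge_le hε v)
    ⟨ε, fun _ hu => (le_hinge _ _).trans hu⟩

/-- Monotonicity also supplies the Borel measurability needed for random variances. -/
theorem antitone_offset {ε : ℝ} (hε : 0 < ε) : Antitone (offset ε) := by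
  intro v v' h
  exact le_offset ((hinge_mono_right _ (Real.sqrt_nonneg _) (Real.sqrt_le_sqrt h)).trans
    (hinge_offset_le hε v'))

/-! ### Linear combinations of independent normal variables -/

theorem map_sum_mul_normal {Ω : Type*} [MeasurableSpace Ω] {μ : Measure Ω} [IsProbabilityMeasure μ]
    {ι : Type*} {Z : ι → Ω → ℝ} (hZ : ∀ i, Measurable (Z i))
    (hlaw : ∀ i, HasLaw (Z i) (gaussianReal 0 1) μ) (hind : iIndepFun Z μ) (c : ι → ℝ)
    (s : Finset ι) :
    μ.map (fun ω => ∑ i ∈ s, c i * Z i ω) = gaussianReal 0 (∑ i ∈ s, c i ^ 2).toNNReal := by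
  have hsum : ∀ s : Finset ι, (fun ω => ∑ i ∈ s, c i * Z i ω) =
      ∑ i ∈ s, fun ω => c i * Z i ω := fun s => by ext ω; simp
  induction s using Finset.induction_on with
  | empty => simp [Measure.map_const, gaussianReal_zero_var]
  | insert i s hi ih =>
    have hind' : iIndepFun (fun i ω => c i * Z i ω) μ :=
      hind.comp (fun i x => c i * x) (fun i => by fun_prop)
    have h1 := hind'.indepFun_finsetSum_of_notMem (fun i => (hZ i).const_mul _) hi
    rw [← hsum] at h1
    have h2 : μ.map (fun ω => c i * Z i ω) = gaussianReal 0 (c i ^ 2).toNNReal := by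
      have := gaussianReal_map_const_mul (μ := 0) (v := 1) (c i)
      rw [← (hlaw i).map_eq, Measure.map_map (by fun_prop) (hZ i)] at this
      have h3 : (NNReal.mk (c i ^ 2) (sq_nonneg _)) * 1 = (c i ^ 2).toNNReal := by
        ext; simp [sq_nonneg]
      rw [h3, mul_zero] at this
      exact this
    have h3 := gaussianReal_add_gaussianReal_of_indepFun h1 ih h2
    rw [Finset.sum_insert hi, add_comm (c i ^ 2), Real.toNNReal_add
      (Finset.sum_nonneg fun i _ => sq_nonneg _) (sq_nonneg _)]
    rw [add_zero] at h3
    rw [← h3]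
    congr 1
    ext ω
    simp [Finset.sum_insert hi, add_comm]

theorem lintegral_max_offset_le {Ω : Type*} [MeasurableSpace Ω] {μ : Measure Ω}
    [IsProbabilityMeasure μ] {ι : Type*} {Z : ι → Ω → ℝ} (hZ : ∀ i, Measurable (Z i))
    (hlaw : ∀ i, HasLaw (Z i) (gaussianReal 0 1) μ) (hind : iIndepFun Z μ) (c : ι → ℝ)
    (s : Finset ι) {ε : ℝ} (hε : 0 < ε) :
    ∫⁻ ω, ENNReal.ofReal (max (offset ε (∑ i ∈ s, c i ^ 2) - ∑ i ∈ s, c i * Z i ω) 0) ∂μ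
      ≤ ENNReal.ofReal ε := by
  set v := ∑ i ∈ s, c i ^ 2
  set u := offset ε v
  have h1 := map_sum_mul_normal hZ hlaw hind c s
  rw [gaussianReal_eq_map] at h1
  have h2 : ∫⁻ ω, ENNReal.ofReal (max (u - ∑ i ∈ s, c i * Z i ω) 0) ∂μ =
      ∫⁻ t, ENNReal.ofReal (max (u - √v * t) 0) ∂(gaussianReal 0 1) := by
    rw [← lintegral_map (f := fun x => ENNReal.ofReal (max (u - x) 0))
      (g := fun ω => ∑ i ∈ s, c i * Z i ω) (by fun_prop) (by fun_prop), h1,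
      lintegral_map (by fun_prop) (by fun_prop)]
    simp only [zero_add]
    rfl
  rw [h2, ← ofReal_integral_eq_lintegral_ofReal (integrable_hinge _ _)
    (ae_of_all _ fun _ => le_max_right _ _)]
  exact ENNReal.ofReal_le_ofReal (hinge_offset_le hε v)

theorem measurable_indicator_prod_pi {Ω : Type*} {m : MeasurableSpace Ω} {ι : Type*} {A : Set Ω}
    (hA : MeasurableSet A) {c : ι → Ω → ℝ} (hc : ∀ i, Measurable (c i)) (s : Finset ι) :
    Measurable fun ω => ((A.indicator 1 ω : ENNReal), fun i : s => c i ω) :=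
  (measurable_one.indicator hA).prodMk (measurable_pi_lambda _ fun i => hc i)

/-- The same with random coefficients that are independent of the normal variables. -/
theorem setLIntegral_max_offset_le {Ω : Type*} {m : MeasurableSpace Ω} [mΩ : MeasurableSpace Ω]
    {μ : Measure Ω} [IsProbabilityMeasure μ] (hm : m ≤ mΩ) {ι : Type*} {Z : ι → Ω → ℝ}
    (hZ : ∀ i, Measurable (Z i)) (hlaw : ∀ i, HasLaw (Z i) (gaussianReal 0 1) μ)
    (hind : iIndepFun Z μ)
    (hindep : Indep (⨆ i, MeasurableSpace.comap (Z i) inferInstance) m μ)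
    {c : ι → Ω → ℝ} (hc : ∀ i, Measurable[m] (c i)) (s : Finset ι) {A : Set Ω}
    (hA : MeasurableSet[m] A) {ε : ℝ} (hε : 0 < ε) :
    ∫⁻ ω in A, ENNReal.ofReal
      (max (offset ε (∑ i ∈ s, c i ω ^ 2) - ∑ i ∈ s, c i ω * Z i ω) 0) ∂μ
      ≤ ENNReal.ofReal ε * μ A := by
  -- Event and coefficients are bundled into one `m`-measurable variable, independent of the normal
  -- vector `W`; by Fubini the case of constant coefficients applies for each fixed value of it.
  let U : Ω → ENNReal × (s → ℝ) := fun ω => (A.indicator 1 ω, fun i => c i ω)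
  let W : Ω → s → ℝ := fun ω i => Z i ω
  have hUm : Measurable[m] U := measurable_indicator_prod_pi (m := m) hA hc s
  have hU : Measurable U := hUm.mono hm le_rfl
  have hW : Measurable W := measurable_pi_lambda _ fun i => hZ i
  have hWm : Measurable[⨆ i, MeasurableSpace.comap (Z i) inferInstance] W :=
    @measurable_pi_lambda _ _ _ (⨆ i, MeasurableSpace.comap (Z i) inferInstance) _ W fun i =>
      (comap_measurable (Z i)).mono
        (le_iSup (fun i => MeasurableSpace.comap (Z i) inferInstance) (i : ι)) le_rfl
  have hUW : IndepFun U W μ := by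
    have h1 : Indep (MeasurableSpace.comap U inferInstance) (MeasurableSpace.comap W inferInstance)
        μ := indep_of_indep_of_le_left (indep_of_indep_of_le_right hindep.symm
          (hWm.comap_le)) hUm.comap_le
    exact h1
  have hoff := (antitone_offset hε).measurable
  let F : (ENNReal × (s → ℝ)) × (s → ℝ) → ENNReal := fun q =>
    q.1.1 * ENNReal.ofReal (max (offset ε (∑ i, q.1.2 i ^ 2) - ∑ i, q.1.2 i * q.2 i) 0)
  have hF : Measurable F := by
    refine Measurable.mul (by fun_prop) (ENNReal.measurable_ofReal.comp ?_)
    refine Measurable.max (Measurable.sub (hoff.comp ?_) ?_) measurable_const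
    · fun_prop
    · fun_prop
  have e1 : ∫⁻ ω in A, ENNReal.ofReal
      (max (offset ε (∑ i ∈ s, c i ω ^ 2) - ∑ i ∈ s, c i ω * Z i ω) 0) ∂μ =
      ∫⁻ ω, F (U ω, W ω) ∂μ := by
    rw [← lintegral_indicator (hm _ hA)]
    refine lintegral_congr fun ω => ?_
    have a1 : ∑ i : s, c i ω ^ 2 = ∑ i ∈ s, c i ω ^ 2 := Finset.sum_coe_sort s (fun i => c i ω ^ 2)
    have a2 : ∑ i : s, c i ω * Z i ω = ∑ i ∈ s, c i ω * Z i ω :=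
      Finset.sum_coe_sort s (fun i => c i ω * Z i ω)
    simp only [F, U, W, a1, a2]
    by_cases h : ω ∈ A <;> simp [h]
  rw [e1, ← lintegral_map (f := F) hF (hU.prodMk hW),
    hUW.map_prod_eq_prod_map_map hU.aemeasurable hW.aemeasurable,
    lintegral_prod _ hF.aemeasurable, lintegral_map hF.lintegral_prod_right' hU]
  calc _ ≤ ∫⁻ ω, A.indicator 1 ω * ENNReal.ofReal ε ∂μ := by
        refine lintegral_mono fun ω => ?_
        rw [lintegral_map (by fun_prop) hW]
        simp only [F]
        rw [lintegral_const_mul _ (by fun_prop)]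
        refine mul_le_mul_right ?_ _
        have := lintegral_max_offset_le hZ hlaw hind (fun i => c i ω) s hε
        refine le_trans (le_of_eq ?_) this
        refine lintegral_congr fun ω' => ?_
        have a1 : ∑ i : s, c i ω ^ 2 = ∑ i ∈ s, c i ω ^ 2 :=
          Finset.sum_coe_sort s (fun i => c i ω ^ 2)
        have a2 : ∑ i : s, c i ω * Z i ω' = ∑ i ∈ s, c i ω * Z i ω' :=
          Finset.sum_coe_sort s (fun i => c i ω * Z i ω')
        simp only [U, W, a1, a2]
    _ = ENNReal.ofReal ε * μ A := by
        rw [lintegral_mul_const _ (measurable_one.indicator (hm _ hA)),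
          lintegral_indicator_one (hm _ hA), mul_comm]

/-! ### The second-stage search -/

/-- A terminated scenario satisfied the stopping criterion for some design set reached during the
search, and its current solution did not change afterwards. -/
theorem SearchStep.exists_design_of_mem_done {Y Ξ : Type*} {q : Y × Ξ → ℝ}
    {mean : Finset (Y × Ξ) → Y × Ξ → ℝ} {cov : Finset (Y × Ξ) → Y × Ξ → Y × Ξ → ℝ} {ξ : ℕ → Ξ}
    {N : ℕ} {α : ℝ} {st st' : SearchState Y Ξ}
    (h : Relation.ReflTransGen (SearchStep q mean cov ξ N α) st st') (h0 : st.done = ∅) :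
    st.design ⊆ st'.design ∧ ∀ j ∈ st'.done, ∃ P, st.design ⊆ P ∧ P ⊆ st'.design ∧
      ∀ y, expImprovement (q (st'.best j, ξ j)) (mean P (y, ξ j)) (cov P (y, ξ j) (y, ξ j)) ≤
        α * |q (st'.best j, ξ j)| := by
  induction h with
  | refl => simp [h0]
  | tail hst hstep ih =>
    obtain ⟨hsub, hdone⟩ := ih
    cases hstep with
    | terminate j y hj hnot hmax hle =>
      refine ⟨hsub, fun i hi => ?_⟩
      rcases Finset.mem_insert.1 hi with rfl | hi
      · exact ⟨_, hsub, subset_rfl, fun y' => (hmax y').trans hle⟩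
      · exact hdone i hi
    | simulate j y hj hnot hmax hlt =>
      refine ⟨hsub.trans (Finset.subset_insert _ _), fun i hi => ?_⟩
      have hij : i ≠ j := fun h => hnot (h ▸ hi)
      obtain ⟨P, h1, h2, h3⟩ := hdone i hi
      refine ⟨P, h1, h2.trans (Finset.subset_insert _ _), fun y' => ?_⟩
      simpa only [Function.update_of_ne hij] using h3 y'

/-- A small expected improvement for some design set bounds the true improvement, and the expected
improvement for all larger design sets. -/
theorem improvement_le_of_expImprovement_le {Z : Type*} {R : Z → Z → ℝ} (hR : IsCorrelation R)
    {q : Z → ℝ} {M : ℝ} (hM : 0 ≤ M) (hq : RKHSNormLE R q M) {P P' : Finset Z} (hP : P.Nonempty)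
    (hPP : P ⊆ P') {v0 v1 σ2 : ℝ} (hv0 : 0 < v0) (h0 : v0 ≤ σ2) (h1 : σ2 ≤ v1) {C b α : ℝ}
    (hqC : ∀ z, |q z| ≤ C) (hb : |b| ≤ C) (hα : 0 < α) (z : Z)
    (hEI : expImprovement b (krigMean R 0 P q z) (σ2 * krigCov R 0 P z z) ≤ α * |b|) :
    let c := (C + Real.exp (4 * (M / √v0) ^ 2) * (2 * C + (3 * (M / √v0) + 1) * √(4 * v1))) / 2
    hinge (b - krigMean R 0 P' q z) √(σ2 * krigCov R 0 P' z z) ≤ c * √α ∧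
      b - q z ≤ c * √α := by
  intro c
  -- Bound of the prediction error in units of the posterior standard deviation; dividing by √v0
  -- accounts for the scaling of the correlation by `σ2 ≥ v0`.
  set K := M / √v0 with hK
  have hσ : 0 < σ2 := hv0.trans_le h0
  have hK0 : 0 ≤ K := by positivity
  have hC : 0 ≤ C := (abs_nonneg _).trans hb
  have herr : ∀ {Q : Finset Z}, Q.Nonempty →
      |q z - krigMean R 0 Q q z| ≤ K * √(σ2 * krigCov R 0 Q z z) := by
    intro Q hQ
    refine (abs_sub_krigMean_le hR hq hQ z).trans ?_
    rw [Real.sqrt_mul hσ.le, ← mul_assoc]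
    refine mul_le_mul_of_nonneg_right ?_ (Real.sqrt_nonneg _)
    rw [hK, div_mul_eq_mul_div, le_div_iff₀ (Real.sqrt_pos.2 hv0)]
    exact mul_le_mul_of_nonneg_left (Real.sqrt_le_sqrt h0) hM
  have hss : √(σ2 * krigCov R 0 P' z z) ≤ √(σ2 * krigCov R 0 P z z) :=
    Real.sqrt_le_sqrt (mul_le_mul_of_nonneg_left (krigCov_anti hR hq hP hPP z) hσ.le)
  have hs1 : √(σ2 * krigCov R 0 P z z) ≤ √(4 * v1) := by
    refine Real.sqrt_le_sqrt ?_
    have := hq.krigCov_le_four hR hP z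
    have := hq.krigCov_nonneg hR hP z
    nlinarith
  rw [expImprovement_eq_hinge] at hEI
  have e1 := abs_le.1 (herr hP)
  have e2 := abs_le.1 (herr (hP.mono hPP))
  have hs0 := Real.sqrt_nonneg (σ2 * krigCov R 0 P z z)
  have hs0' := Real.sqrt_nonneg (σ2 * krigCov R 0 P' z z)
  set s := √(σ2 * krigCov R 0 P z z)
  set s' := √(σ2 * krigCov R 0 P' z z)
  -- The posterior mean exceeds the true value by at most `K * s`, so the stopping criterion
  -- controls the pessimistic value.
  have f1 : hinge (b - q z - K * s) s ≤ α * C :=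
    (hinge_mono_left (by linarith) s).trans (hEI.trans (mul_le_mul_of_nonneg_left hb hα.le))
  have f2 : hinge (b - krigMean R 0 P' q z) s' ≤ hinge (b - q z + K * s) s :=
    (hinge_mono_left (by linarith) s').trans (hinge_add_mul_mono hK0 (b - q z) hs0' hss)
  have f3 : b - q z ≤ hinge (b - q z + K * s) s :=
    le_trans (by nlinarith) (le_hinge _ _)
  have hsα : 0 < √α := Real.sqrt_pos.2 hα
  -- The choice `l = 1/√α` balances the terms: the first is `l · O(α)`, the second `l⁻¹ · O(1)`,
  -- both of order √α.
  have f4 := hinge_shift_le (b - q z) s K (inv_pos.2 hsα)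
  have f5 : hinge (b - q z + 3 * K * s) s ≤ 2 * C + (3 * K + 1) * √(4 * v1) := by
    refine (hinge_le _ hs0).trans ?_
    have g1 : |b - q z + 3 * K * s| ≤ |b| + |q z| + 3 * K * s := by
      refine (abs_add_le _ _).trans (add_le_add (abs_sub _ _) ?_)
      rw [abs_of_nonneg (by positivity)]
    have g2 : 3 * K * s ≤ 3 * K * √(4 * v1) := by gcongr
    linarith [hqC z]
  have f6 : hinge (b - q z + K * s) s ≤ c * √α := by
    refine f4.trans ?_
    rw [inv_inv]
    have g1 : (√α)⁻¹ * hinge (b - q z - K * s) s ≤ √α * C := by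
      rw [inv_mul_le_iff₀ hsα]
      calc _ ≤ α * C := f1
        _ = √α * (√α * C) := by rw [← mul_assoc, Real.mul_self_sqrt hα.le]
    have g2 := mul_le_mul_of_nonneg_left f5
      (show 0 ≤ √α * Real.exp (4 * K ^ 2) by positivity)
    have g3 : c * √α = (√α * C + √α * Real.exp (4 * K ^ 2) *
      (2 * C + (3 * K + 1) * √(4 * v1))) / 2 := by simp only [c]; ring
    rw [g3]
    linarith
  exact ⟨f2.trans f6, f3.trans f6⟩

/-! ### Thresholds and numbers of scenarios -/

theorem Params.threshold_pos (a : Params) (t : ℕ) : 0 < a.threshold t :=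
  mul_pos a.α0_pos (Real.rpow_pos_of_pos (zero_lt_one.trans a.one_lt_g) _)

theorem Params.sqrt_threshold (a : Params) (t : ℕ) :
    √(a.threshold t) = √a.α0 * a.g ^ (1 / 4 : ℝ) * (a.g ^ (-(1 / 4) : ℝ)) ^ t := by
  have hg : 0 < a.g := zero_lt_one.trans a.one_lt_g
  rw [Params.threshold, Real.sqrt_mul a.α0_pos.le, Real.sqrt_eq_rpow (a.g ^ _),
    ← Real.rpow_mul hg.le, ← Real.rpow_natCast, ← Real.rpow_mul hg.le, mul_assoc,
    ← Real.rpow_add hg]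
  congr 2
  ring

/-- The square roots are geometric with ratio g^(-1/4) < 1; summability drives the Borel–Cantelli
type argument for the posterior paths. -/
theorem Params.summable_sqrt_threshold (a : Params) : Summable fun t => √(a.threshold t) := by
  simp_rw [a.sqrt_threshold]
  refine (summable_geometric_of_lt_one (Real.rpow_nonneg
    (zero_lt_one.trans a.one_lt_g).le _) ?_).mul_left _
  exact Real.rpow_lt_one_of_one_lt_of_neg a.one_lt_g (by norm_num)

theorem Params.tendsto_numScen (a : Params) : Tendsto a.numScen atTop atTop := by
  have h1 : Tendsto (fun t : ℕ => (a.n0 : ℝ) * a.g ^ (t - 1)) atTop atTop :=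
    ((tendsto_pow_atTop_atTop_of_one_lt a.one_lt_g).comp
      (tendsto_sub_atTop_nat 1)).const_mul_atTop (by exact_mod_cast a.n0_pos)
  refine (tendsto_nat_ceil_atTop.comp h1).congr' ?_
  filter_upwards [eventually_ge_atTop 1] with t ht
  simp [Params.numScen, Nat.one_le_iff_ne_zero.1 ht]

theorem Params.numScen_pos (a : Params) {t : ℕ} (ht : t ≠ 0) : 0 < a.numScen t := by
  rw [Params.numScen, if_neg ht, Nat.ceil_pos]
  have : (0 : ℝ) < a.n0 := by exact_mod_cast a.n0_pos
  have := a.one_lt_g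
  positivity

/-! ### Improvements left by the search at one first-stage point -/

namespace Execution

variable {X : Type*} {Y : X → Type*} {Ξ : Type*} [MeasurableSpace Ξ]
  {p : Problem X Y Ξ} {a : Params} {Φ Ψ : Type*}
  {R : (x : X) → Φ → Y x × Ξ → Y x × Ξ → ℝ} {r : Ψ → X → X → ℝ}
  {Ω : Type*} [mΩ : MeasurableSpace Ω] [Fintype X] [∀ x, Fintype (Y x)]
  {E : Execution p a R r Ω} {μ : Measure Ω}

theorem IsRun.startDesign_nonempty (hE : E.IsRun μ) (k : ℕ) (x : X) (ω : Ω) :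
    (E.startDesign k x ω).Nonempty := by
  induction k with
  | zero => exact hE.design0_nonempty x ω
  | succ k ih =>
    change (E.design k x ω).Nonempty
    by_cases hx : x ∈ E.D k ω
    · obtain ⟨st, st', h1, h2, -, -, h3, -, h4, -⟩ := hE.search k x ω hx
      rw [h4]
      exact (h1 ▸ ih : st.design.Nonempty).mono (SearchStep.exists_design_of_mem_done h3 h2).1
    · rw [hE.design_skip k x ω hx]; exact ih

/-- Late visits leave only small improvements, both true ones and expected ones. -/
theorem IsRun.exists_improvement_le [TopologicalSpace Φ] (hE : E.IsRun μ)
    (hR : ∀ x φ, IsCorrelation (R x φ)) (x : X) {σ2 : ℝ} (hσ2 : 0 < σ2) {φ : Φ}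
    (hbdd : ∃ C : ℝ, ∀ z, |p.q x z| ≤ C)
    (hrkhs : ∃ M : ℝ, ∀ᶠ φ' in 𝓝 φ, RKHSNormLE (R x φ') (p.q x) M) :
    ∃ c : ℝ, 0 < c ∧ ∀ ω, Tendsto (fun k => (E.sigma2 k x ω, E.phi k x ω))
      (atTop ⊓ 𝓟 {k | x ∈ E.D k ω}) (𝓝 (σ2, φ)) →
      ∀ᶠ k in atTop ⊓ 𝓟 {k | x ∈ E.D k ω}, ∀ j < E.N k x ω, ∀ y,
        p.q x (E.sol k x ω j, E.scen x j ω) - E.pathMean k x (y, j) ω ≤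
          offset (c * √(a.threshold (E.visits k x ω)))
            (∑ m ∈ (Finset.univ : Finset (Y x)) ×ˢ Finset.range (E.N k x ω),
              E.root k x (y, j) m ω ^ 2) ∧
        p.q x (E.sol k x ω j, E.scen x j ω) - p.q x (y, E.scen x j ω) ≤
          c * √(a.threshold (E.visits k x ω)) := by
  obtain ⟨C, hC⟩ := hbdd
  obtain ⟨M, hM⟩ := hrkhs
  have hC' : ∀ z, |p.q x z| ≤ max C 0 := fun z => (hC z).trans (le_max_left _ _)
  have hM' : ∀ᶠ φ' in 𝓝 φ, RKHSNormLE (R x φ') (p.q x) (max M 0) := by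
    filter_upwards [hM] with φ' ⟨H, i1, i2, i3, i4, h1, h, h2, h3⟩
    exact ⟨H, i1, i2, i3, i4, h1, h, h2, h3.trans (le_max_left _ _)⟩
  have hM0 : 0 ≤ max M 0 := le_max_right _ _
  have hC0 : 0 ≤ max C 0 := le_max_right _ _
  set M' := max M 0
  set C' := max C 0
  -- The constant of `improvement_le_of_expImprovement_le` for variance estimates between `σ2 / 2`
  -- and `2 * σ2`. It does not depend on the outcome, so the resulting bounds form a deterministic
  -- sequence, as `tendsto_excess` requires.
  set c := (C' + Real.exp (4 * (M' / √(σ2 / 2)) ^ 2) *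
    (2 * C' + (3 * (M' / √(σ2 / 2)) + 1) * √(4 * (2 * σ2)))) / 2
  have hc : 0 < c := by positivity
  refine ⟨c, hc, fun ω hω => ?_⟩
  rw [nhds_prod_eq] at hω
  have hω1 := (tendsto_fst.comp hω).eventually (Ioo_mem_nhds (half_lt_self hσ2)
    (by linarith : σ2 < 2 * σ2))
  have hω2 := (tendsto_snd.comp hω).eventually hM'
  have hω3 : ∀ᶠ k in atTop ⊓ 𝓟 {k | x ∈ E.D k ω}, x ∈ E.D k ω :=
    eventually_inf_principal.2 (Eventually.of_forall fun _ h => h)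
  filter_upwards [hω1, hω2, hω3] with k h1 h2 hx j hj y
  obtain ⟨st, st', g1, g2, -, -, g3, g4, g5, g6⟩ := hE.search k x ω hx
  obtain ⟨-, g7⟩ := SearchStep.exists_design_of_mem_done g3 g2
  obtain ⟨P, p1, p2, p3⟩ := g7 j (by rw [g4]; exact Finset.mem_range.2 hj)
  have hP : P.Nonempty := by
    refine Finset.Nonempty.mono p1 ?_
    rw [g1]; exact hE.startDesign_nonempty k x ω
  have key := improvement_le_of_expImprovement_le (hR x _) hM0 h2 hP p2 (half_pos hσ2) h1.1.le
    h1.2.le hC' (hC' (st'.best j, E.scen x j ω)) (a.threshold_pos (E.visits k x ω)) _ (p3 y)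
  rw [g6]
  refine ⟨le_offset ?_, key.2⟩
  have e1 := hE.root_eq k x ω hx y y j hj j hj
  simp only [← sq] at e1
  rw [e1, hE.pathMean_eq k x ω hx y j hj, g5]
  exact key.1

end Execution

namespace Execution

variable {X : Type*} {Y : X → Type*} {Ξ : Type*} [MeasurableSpace Ξ]
  {p : Problem X Y Ξ} {a : Params} {Φ Ψ : Type*}
  {R : (x : X) → Φ → Y x × Ξ → Y x × Ξ → ℝ} {r : Ψ → X → X → ℝ}
  {Ω : Type*} [mΩ : MeasurableSpace Ω] {E : Execution p a R r Ω} {μ : Measure Ω}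

/-! ### Visits -/

theorem measurable_sum_indicator_one {Ω : Type*} {m : MeasurableSpace Ω} (s : Finset ℕ)
    {A : ℕ → Set Ω} (hA : ∀ i ∈ s, MeasurableSet (A i)) :
    Measurable fun ω => ∑ i ∈ s, (A i).indicator (1 : Ω → ℕ) ω :=
  Finset.measurable_sum _ fun i hi => measurable_one.indicator (hA i hi)

theorem visits_eq_sum (k : ℕ) (x : X) (ω : Ω) :
    E.visits k x ω = ∑ i ∈ Finset.range (k + 1), {ω | x ∈ E.D i ω}.indicator 1 ω := by
  rw [visits, visitsBefore, Finset.card_filter]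
  refine Finset.sum_congr rfl fun i _ => ?_
  by_cases h : x ∈ E.D i ω <;> simp [h]

/-- The event that the `t`-th visit to `x` takes place in iteration `k`. -/
def visitEvent (E : Execution p a R r Ω) (x : X) (k t : ℕ) : Set Ω :=
  {ω | x ∈ E.D k ω ∧ E.visits k x ω = t}

theorem visits_mono (x : X) (ω : Ω) : Monotone fun k => E.visits k x ω := by
  intro k k' h
  exact Finset.card_le_card (Finset.filter_subset_filter (fun i => x ∈ E.D i ω)
    (Finset.range_mono (Nat.succ_le_succ h)))

theorem visits_succ (k : ℕ) (x : X) (ω : Ω) :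
    E.visits (k + 1) x ω = E.visits k x ω + if x ∈ E.D (k + 1) ω then 1 else 0 := by
  rw [visits_eq_sum, visits_eq_sum, Finset.sum_range_succ _ (k + 1)]
  simp [Set.indicator_apply]

theorem visits_lt_of_mem {x : X} {ω : Ω} {k k' : ℕ} (h : k < k') (hx : x ∈ E.D k' ω) :
    E.visits k x ω < E.visits k' x ω := by
  obtain ⟨l, rfl⟩ : ∃ l, k' = l + 1 := ⟨k' - 1, by omega⟩
  have h1 := visits_succ (E := E) l x ω
  rw [if_pos hx] at h1
  have h2 := visits_mono (E := E) x ω (Nat.lt_succ_iff.1 h)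
  simp only at h2
  omega

theorem visits_pos {x : X} {ω : Ω} {k : ℕ} (hx : x ∈ E.S k ω) : E.visits k x ω ≠ 0 := by
  obtain ⟨i, hi, hx⟩ := Finset.mem_biUnion.1 hx
  exact (Finset.card_pos.2 ⟨i, Finset.mem_filter.2 ⟨hi, hx⟩⟩).ne'

theorem mem_S_of_mem_D {x : X} {ω : Ω} {k : ℕ} (hx : x ∈ E.D k ω) : x ∈ E.S k ω :=
  Finset.mem_biUnion.2 ⟨k, Finset.self_mem_range_succ k, hx⟩

theorem pairwise_disjoint_visitEvent (x : X) (t : ℕ) :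
    Pairwise (Function.onFun Disjoint fun k => E.visitEvent x k t) := by
  have key : ∀ k k', k < k' → Disjoint (E.visitEvent x k t) (E.visitEvent x k' t) := by
    intro k k' h
    rw [Set.disjoint_left]
    rintro ω ⟨-, h1⟩ ⟨h2, h3⟩
    have := visits_lt_of_mem h h2
    omega
  intro k k' h
  rcases h.lt_or_gt with h | h
  · exact key _ _ h
  · exact (key _ _ h).symm

/-! ### Visits are known before the posterior paths are drawn -/

section Measurability

variable [Fintype X] [∀ x, Fintype (Y x)]

theorem IsRun.monotone_pre (hE : E.IsRun μ) : Monotone E.pre :=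
  monotone_nat_of_le_succ fun k => (hE.pre_le_hist k).trans (hE.hist_le_pre k)

theorem IsRun.pre_le (hE : E.IsRun μ) (k : ℕ) : E.pre k ≤ mΩ :=
  (hE.pre_le_hist k).trans (E.hist.le k)

theorem IsRun.measurableSet_mem_D (hE : E.IsRun μ) (k : ℕ) (x : X) :
    MeasurableSet[E.pre k] {ω | x ∈ E.D k ω} := by
  cases k with
  | zero => exact hE.D_zero_meas x
  | succ k =>
    have : {ω | x ∈ E.D (k + 1) ω} = ⋃ i, {ω | E.draw k i ω = x} := by
      ext ω; simp [hE.D_succ]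
    rw [this]
    exact MeasurableSet.iUnion fun i => hE.draw_meas k i x

theorem IsRun.measurableSet_visitEvent (hE : E.IsRun μ) (x : X) (k t : ℕ) :
    MeasurableSet[E.pre k] (E.visitEvent x k t) := by
  have h1 : Measurable[E.pre k] (E.visits k x) := by
    have : E.visits k x =
        fun ω => ∑ i ∈ Finset.range (k + 1), {ω | x ∈ E.D i ω}.indicator 1 ω := by
      ext ω; exact visits_eq_sum k x ω
    rw [this]
    refine measurable_sum_indicator_one (m := E.pre k) _ fun i hi => ?_
    exact hE.monotone_pre (Nat.lt_succ_iff.1 (Finset.mem_range.1 hi)) _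
      (hE.measurableSet_mem_D i x)
  exact MeasurableSet.inter (hE.measurableSet_mem_D k x) (h1 (measurableSet_singleton t))

end Measurability

/-! ### Posterior sample paths -/

section Paths

variable [∀ x, Fintype (Y x)]

/-- Excess of one normal variable over the offset for which its expected value is at most `ε`. -/
noncomputable def excessTerm (E : Execution p a R r Ω) (ε : ℝ) (x : X) (k n j : ℕ)
    (l : Fin a.B × Y x) (ω : Ω) : ℝ :=
  max (offset ε (∑ m ∈ (Finset.univ : Finset (Y x)) ×ˢ Finset.range n,
      E.root k x (l.2, j) m ω ^ 2) -
    ∑ m ∈ (Finset.univ : Finset (Y x)) ×ˢ Finset.range n,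
      E.root k x (l.2, j) m ω * E.normal k x l.1 m ω) 0

/-- Bound of the averaged optimality gap estimates with `n` scenarios. -/
noncomputable def excess (E : Execution p a R r Ω) (ε : ℝ) (x : X) (k n : ℕ) (ω : Ω) : ℝ :=
  (1 / (n * a.B : ℝ)) * ∑ i ∈ Finset.range n ×ˢ (Finset.univ : Finset (Fin a.B × Y x)),
    E.excessTerm ε x k n i.1 i.2 ω

theorem excessTerm_nonneg (ε : ℝ) (x : X) (k n j : ℕ) (l : Fin a.B × Y x) (ω : Ω) :
    0 ≤ E.excessTerm ε x k n j l ω := le_max_right _ _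

theorem excess_nonneg (ε : ℝ) (x : X) (k n : ℕ) (ω : Ω) : 0 ≤ E.excess ε x k n ω :=
  mul_nonneg (by positivity) (Finset.sum_nonneg fun _ _ => excessTerm_nonneg _ _ _ _ _ _ _)

variable [Fintype X]

theorem IsRun.measurable_excessTerm (hE : E.IsRun μ) {ε : ℝ} (hε : 0 < ε) (x : X) (k n j : ℕ)
    (l : Fin a.B × Y x) : Measurable (E.excessTerm ε x k n j l) := by
  have h1 : ∀ l m, Measurable (E.root k x l m) := fun l m =>
    (hE.root_meas k x l m).mono (hE.pre_le k) le_rfl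
  have h2 : ∀ b m, Measurable (E.normal k x b m) := fun b m =>
    (hE.normal_meas k x b m).mono (E.hist.le k) le_rfl
  refine Measurable.max (Measurable.sub ((antitone_offset hε).measurable.comp ?_) ?_)
    measurable_const
  · exact Finset.measurable_sum _ fun m _ => (h1 _ _).pow_const 2
  · exact Finset.measurable_sum _ fun m _ => (h1 _ _).mul (h2 _ _)

theorem IsRun.setLIntegral_excessTerm_le [IsProbabilityMeasure μ] (hE : E.IsRun μ) {ε : ℝ}
    (hε : 0 < ε) (x : X) (k n j : ℕ) (l : Fin a.B × Y x) {A : Set Ω}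
    (hA : MeasurableSet[E.pre k] A) :
    ∫⁻ ω in A, ENNReal.ofReal (E.excessTerm ε x k n j l ω) ∂μ ≤ ENNReal.ofReal ε * μ A := by
  refine setLIntegral_max_offset_le (hE.pre_le k) (Z := fun m => E.normal k x l.1 m)
    (fun m => (hE.normal_meas k x l.1 m).mono (E.hist.le k) le_rfl)
    (fun m => hE.normal_law k x l.1 m) ?_ ?_ (c := fun m => E.root k x (l.2, j) m)
    (fun m => hE.root_meas k x _ m) _ hA hε
  · refine (hE.normal_indep k).precomp
      (g := fun m : Y x × ℕ => (⟨x, l.1, m⟩ : Σ x : X, Fin a.B × (Y x × ℕ))) ?_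
    intro m m' h
    simpa using h
  · refine indep_of_indep_of_le_left (hE.normal_indep_pre k) (iSup_le fun m => ?_)
    exact le_iSup_of_le x (le_iSup_of_le l.1 (le_iSup_of_le m le_rfl))

theorem IsRun.measurable_excess (hE : E.IsRun μ) {ε : ℝ} (hε : 0 < ε) (x : X) (k n : ℕ) :
    Measurable (E.excess ε x k n) :=
  (Finset.measurable_sum _ fun _ _ => hE.measurable_excessTerm hε x k n _ _).const_mul _

/-- Scenarios and sample paths are averaged, only the decisions are summed; hence the factor |Y(x)|,
independent of `n` and of the number of paths. -/
theorem IsRun.setLIntegral_excess_le [IsProbabilityMeasure μ] (hE : E.IsRun μ) {ε : ℝ}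
    (hε : 0 < ε) (x : X) (k : ℕ) {n : ℕ} (hn : 0 < n) {A : Set Ω}
    (hA : MeasurableSet[E.pre k] A) :
    ∫⁻ ω in A, ENNReal.ofReal (E.excess ε x k n ω) ∂μ ≤
      ENNReal.ofReal (Fintype.card (Y x) * ε) * μ A := by
  have hB := a.B_pos
  have h1 : ∀ ω, ENNReal.ofReal (E.excess ε x k n ω) = ENNReal.ofReal (1 / (n * a.B : ℝ)) *
      ∑ i ∈ Finset.range n ×ˢ (Finset.univ : Finset (Fin a.B × Y x)),
        ENNReal.ofReal (E.excessTerm ε x k n i.1 i.2 ω) := by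
    intro ω
    rw [excess, ENNReal.ofReal_mul (by positivity),
      ENNReal.ofReal_sum_of_nonneg fun _ _ => excessTerm_nonneg _ _ _ _ _ _ _]
  have h2 : ∀ i : ℕ × (Fin a.B × Y x),
      Measurable fun ω => ENNReal.ofReal (E.excessTerm ε x k n i.1 i.2 ω) := fun i =>
    ENNReal.measurable_ofReal.comp (hE.measurable_excessTerm hε x k n _ _)
  simp_rw [h1]
  rw [lintegral_const_mul _ (Finset.measurable_sum _ fun i _ => h2 i),
    lintegral_finsetSum _ fun i _ => h2 i]
  calc _ ≤ ENNReal.ofReal (1 / (n * a.B : ℝ)) *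
        ∑ i ∈ Finset.range n ×ˢ (Finset.univ : Finset (Fin a.B × Y x)),
          ENNReal.ofReal ε * μ A := by
        gcongr with i hi
        exact hE.setLIntegral_excessTerm_le hε x k n _ _ hA
    _ = ENNReal.ofReal (Fintype.card (Y x) * ε) * μ A := by
        rw [Finset.sum_const, nsmul_eq_mul, ← mul_assoc, ← mul_assoc, Finset.card_product,
          Finset.card_range, Finset.card_univ, Fintype.card_prod, Fintype.card_fin,
          ← ENNReal.ofReal_natCast, ← ENNReal.ofReal_mul (by positivity),
          ← ENNReal.ofReal_mul (by positivity)]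
        congr 2
        push_cast
        have : (n : ℝ) ≠ 0 := by positivity
        have : (a.B : ℝ) ≠ 0 := by positivity
        field_simp

/-- The bounds of the optimality gap estimates vanish along the visits. -/
theorem IsRun.tendsto_excess [IsProbabilityMeasure μ] (hE : E.IsRun μ) (x : X) {ε : ℕ → ℝ}
    (hε : ∀ t, 0 < ε t) (hsum : Summable ε) :
    ∀ᵐ ω ∂μ, Tendsto (fun k => E.excess (ε (E.visits k x ω)) x k (E.N k x ω) ω)
      (atTop ⊓ 𝓟 {k | x ∈ E.D k ω}) (𝓝 0) := by
  -- Splitting by visit number makes tolerance and number of scenarios deterministic on each event;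
  -- visit numbers start at one.
  let F : ℕ → ℕ → Ω → ENNReal := fun t k => (E.visitEvent x k (t + 1)).indicator
    fun ω => ENNReal.ofReal (E.excess (ε (t + 1)) x k (a.numScen (t + 1)) ω)
  have hA : ∀ k t, MeasurableSet (E.visitEvent x k t) := fun k t =>
    hE.pre_le k _ (hE.measurableSet_visitEvent x k t)
  have hF : ∀ t k, Measurable (F t k) := fun t k =>
    (ENNReal.measurable_ofReal.comp (hE.measurable_excess (hε _) x k _)).indicator (hA _ _)
  have hint : ∫⁻ ω, ∑' k, ∑' t, F t k ω ∂μ ≠ ⊤ := by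
    have h1 : ∫⁻ ω, ∑' k, ∑' t, F t k ω ∂μ = ∑' t, ∑' k, ∫⁻ ω, F t k ω ∂μ := by
      rw [lintegral_tsum fun k => (Measurable.tsum fun t => hF t k).aemeasurable,
        ENNReal.tsum_comm]
      exact tsum_congr fun k => lintegral_tsum fun t => (hF t k).aemeasurable
    have h2 : ∀ t, ∑' k, ∫⁻ ω, F t k ω ∂μ ≤
        ENNReal.ofReal (Fintype.card (Y x) * ε (t + 1)) := by
      intro t
      calc ∑' k, ∫⁻ ω, F t k ω ∂μ ≤ ∑' k, ENNReal.ofReal (Fintype.card (Y x) * ε (t + 1)) *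
            μ (E.visitEvent x k (t + 1)) := by
            refine ENNReal.tsum_le_tsum fun k => ?_
            rw [lintegral_indicator (hA _ _)]
            exact hE.setLIntegral_excess_le (hε _) x k (a.numScen_pos t.succ_ne_zero)
              (hE.measurableSet_visitEvent x k (t + 1))
        -- A given visit takes place in at most one iteration, so the probabilities over `k` add up
        -- to at most one, and the double sum is bounded by the summable tolerances.
        _ = ENNReal.ofReal (Fintype.card (Y x) * ε (t + 1)) *
            μ (⋃ k, E.visitEvent x k (t + 1)) := by
            rw [ENNReal.tsum_mul_left, measure_iUnion (pairwise_disjoint_visitEvent x (t + 1))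
              fun k => hA _ _]
        _ ≤ _ := mul_le_of_le_one_right' prob_le_one
    rw [h1]
    refine ne_top_of_le_ne_top ?_ (ENNReal.tsum_le_tsum h2)
    exact (((summable_nat_add_iff 1).2 hsum).mul_left _).tsum_ofReal_ne_top
  have hmeas : Measurable fun ω => ∑' k, ∑' t, F t k ω :=
    Measurable.tsum fun k => Measurable.tsum fun t => hF t k
  filter_upwards [ae_lt_top hmeas hint] with ω hω
  have h1 := ENNReal.tendsto_atTop_zero_of_tsum_ne_top hω.ne
  have h2 : Tendsto (fun k => (∑' t, F t k ω).toReal) atTop (𝓝 0) := by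
    simpa [Function.comp_def] using (ENNReal.tendsto_toReal ENNReal.zero_ne_top).comp h1
  refine squeeze_zero' (Eventually.of_forall fun k => excess_nonneg _ _ _ _ _) ?_
    (h2.mono_left inf_le_left)
  refine eventually_inf_principal.2 ?_
  have h3 : ∀ᶠ k in atTop, ∑' t, F t k ω < ⊤ := h1.eventually (gt_mem_nhds ENNReal.zero_lt_top)
  filter_upwards [h3] with k hk hx
  rw [← ENNReal.ofReal_le_iff_le_toReal hk.ne]
  obtain ⟨t, ht⟩ := Nat.exists_eq_succ_of_ne_zero (visits_pos (mem_S_of_mem_D hx))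
  refine le_trans (le_of_eq ?_) (ENNReal.le_tsum t)
  have : ω ∈ E.visitEvent x k (t + 1) := ⟨hx, ht⟩
  simp only [F, Set.indicator_of_mem this, N, ht, Nat.succ_eq_add_one]

end Paths

end Execution

namespace Execution

variable {X : Type*} {Y : X → Type*} {Ξ : Type*} [MeasurableSpace Ξ]
  {p : Problem X Y Ξ} {a : Params} {Φ Ψ : Type*}
  {R : (x : X) → Φ → Y x × Ξ → Y x × Ξ → ℝ} {r : Ψ → X → X → ℝ}
  {Ω : Type*} [mΩ : MeasurableSpace Ω] {E : Execution p a R r Ω} {μ : Measure Ω}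

/-! ### Consistency of the estimates along the visits -/

theorem tendsto_visits_of_frequently {x : X} {ω : Ω} (h : ∃ᶠ k in atTop, x ∈ E.D k ω) :
    Tendsto (fun k => E.visits k x ω) atTop atTop := by
  refine tendsto_atTop_atTop_of_monotone (visits_mono x ω) fun b => ?_
  induction b with
  | zero => exact ⟨0, Nat.zero_le _⟩
  | succ b ih =>
    obtain ⟨k, hk⟩ := ih
    obtain ⟨l, hl, hx⟩ := frequently_atTop.1 h (k + 1)
    exact ⟨l, hk.trans_lt (visits_lt_of_mem (E := E) hl hx)⟩

/-- With only finitely many visits the filter is trivial, so limits along visits can be derived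
before it is known that `x` is visited infinitely often. -/
theorem tendsto_visits (E : Execution p a R r Ω) (x : X) (ω : Ω) :
    Tendsto (fun k => E.visits k x ω) (atTop ⊓ 𝓟 {k | x ∈ E.D k ω}) atTop := by
  by_cases h : ∃ᶠ k in atTop, x ∈ E.D k ω
  · exact (tendsto_visits_of_frequently h).mono_left inf_le_left
  · have : atTop ⊓ 𝓟 {k | x ∈ E.D k ω} = ⊥ := by
      rw [← Filter.eventually_false_iff_eq_bot, eventually_inf_principal]
      simpa using h
    rw [this]
    exact tendsto_bot

/-- A budget above the total of the efforts recorded at the first `K` iterations cannot be met by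
any of them. -/
theorem tendsto_stopIter {x : X} {ω : Ω} (hvis : ∃ᶠ k in atTop, x ∈ E.D k ω) :
    Tendsto (fun C => E.stopIter C ω) atTop atTop := by
  have hN : Tendsto (fun k => (E.N k x ω : ℝ)) atTop atTop :=
    tendsto_natCast_atTop_atTop.comp
      (a.tendsto_numScen.comp (tendsto_visits_of_frequently hvis))
  refine tendsto_atTop.2 fun K => ?_
  filter_upwards [eventually_gt_atTop (∑ k ∈ Finset.range K, (E.simRuns k ω : ℝ))] with C hC
  -- The infimum of the empty set would be 0, so the budget must be reached at some iteration; the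
  -- growing number of scenarios at `x` ensures this.
  have hne : {k : ℕ | C ≤ (E.simRuns k ω : ℝ)}.Nonempty := by
    obtain ⟨k0, hk0⟩ := hvis.exists
    obtain ⟨k, hk1, hk2⟩ := ((hN.eventually_ge_atTop C).and (eventually_ge_atTop k0)).exists
    refine ⟨k, hk1.trans ?_⟩
    have hmem : x ∈ E.S k ω :=
      Finset.mem_biUnion.2 ⟨k0, Finset.mem_range.2 (Nat.lt_succ_iff.2 hk2), hk0⟩
    have h1 : (E.design k x ω).card + E.N k x ω ≤ E.simRuns k ω :=
      Finset.single_le_sum (f := fun x => (E.design k x ω).card + E.N k x ω)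
        (fun _ _ => Nat.zero_le _) hmem
    exact_mod_cast (Nat.le_add_left _ _).trans h1
  refine le_csInf hne fun k hk => ?_
  by_contra! hlt
  have h1 : (E.simRuns k ω : ℝ) ≤ ∑ k ∈ Finset.range K, (E.simRuns k ω : ℝ) :=
    Finset.single_le_sum (f := fun k => (E.simRuns k ω : ℝ)) (fun _ _ => Nat.cast_nonneg _)
      (Finset.mem_range.2 hlt)
  have h2 : C ≤ (E.simRuns k ω : ℝ) := hk
  linarith

section

variable [∀ x, Fintype (Y x)]

theorem gapEst_nonneg (k : ℕ) (x : X) (j : ℕ) (ω : Ω) : 0 ≤ E.gapEst k x j ω :=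
  mul_nonneg (by positivity) (Finset.sum_nonneg fun _ _ => le_max_left _ _)

variable [∀ x, Nonempty (Y x)]

/-- Each path attains its minimum at some y, and the nonnegative term for that y is at most the sum
over all decisions. -/
theorem gapEst_le (k : ℕ) (x : X) (j : ℕ) (ω : Ω) {ε : ℝ}
    (h : ∀ y, p.q x (E.sol k x ω j, E.scen x j ω) - E.pathMean k x (y, j) ω ≤
      offset ε (∑ m ∈ (Finset.univ : Finset (Y x)) ×ˢ Finset.range (E.N k x ω),
        E.root k x (y, j) m ω ^ 2)) :
    E.gapEst k x j ω ≤
      (1 / (a.B : ℝ)) * ∑ l : Fin a.B × Y x, E.excessTerm ε x k (E.N k x ω) j l ω := by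
  rw [gapEst, Fintype.sum_prod_type]
  refine mul_le_mul_of_nonneg_left (Finset.sum_le_sum fun b _ => ?_) (by positivity)
  have hnn : ∀ y ∈ (Finset.univ : Finset (Y x)),
      0 ≤ E.excessTerm ε x k (E.N k x ω) j (b, y) ω := fun y _ => excessTerm_nonneg _ _ _ _ _ _ _
  refine max_le (Finset.sum_nonneg hnn) ?_
  obtain ⟨y, hy⟩ := exists_eq_ciInf_of_finite (f := fun y : Y x => E.path k x b (y, j) ω)
  rw [← hy]
  refine le_trans ?_ (Finset.single_le_sum hnn (Finset.mem_univ y))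
  refine le_trans ?_ (le_max_left _ _)
  have := h y
  simp only [path]
  linarith

theorem average_gapEst_le {k : ℕ} {x : X} {ω : Ω} {ε : ℝ}
    (h : ∀ j < E.N k x ω, ∀ y, p.q x (E.sol k x ω j, E.scen x j ω) - E.pathMean k x (y, j) ω ≤
      offset ε (∑ m ∈ (Finset.univ : Finset (Y x)) ×ˢ Finset.range (E.N k x ω),
        E.root k x (y, j) m ω ^ 2)) :
    (1 / (E.N k x ω : ℝ)) * ∑ j ∈ Finset.range (E.N k x ω), E.gapEst k x j ω ≤
      E.excess ε x k (E.N k x ω) ω := by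
  rw [excess, Finset.sum_product, one_div, one_div, mul_inv, mul_assoc]
  refine mul_le_mul_of_nonneg_left ?_ (by positivity)
  rw [Finset.mul_sum]
  refine Finset.sum_le_sum fun j hj => ?_
  simpa [one_div] using gapEst_le k x j ω (h j (Finset.mem_range.1 hj))

variable [Fintype X]

theorem IsRun.tendsto_average_iInf [IsProbabilityMeasure μ] (hE : E.IsRun μ) (x : X)
    [IsProbabilityMeasure p.F]
    (hmeas : ∀ y, Measurable fun ξ => p.q x (y, ξ)) (hbdd : ∃ C : ℝ, ∀ z, |p.q x z| ≤ C) :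
    ∀ᵐ ω ∂μ, Tendsto (fun n : ℕ =>
      (∑ j ∈ Finset.range n, ⨅ y : Y x, p.q x (y, E.scen x j ω)) / n) atTop
      (𝓝 (∫ ξ, (⨅ y : Y x, p.q x (y, ξ)) ∂p.F)) := by
  obtain ⟨C, hC⟩ := hbdd
  have hm : Measurable fun ξ => ⨅ y : Y x, p.q x (y, ξ) := Measurable.iInf hmeas
  have hb : ∀ ξ, ‖⨅ y : Y x, p.q x (y, ξ)‖ ≤ C := by
    intro ξ
    obtain ⟨y, hy⟩ := exists_eq_ciInf_of_finite (f := fun y : Y x => p.q x (y, ξ))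
    rw [← hy]; exact hC _
  have hae := fun j => (hE.scen_law x j).aemeasurable
  have h1 := strong_law_ae_real (μ := μ) (fun j ω => ⨅ y : Y x, p.q x (y, E.scen x j ω))
    (Integrable.of_bound (hm.comp_aemeasurable (hae 0)).aestronglyMeasurable C
      (ae_of_all _ fun ω => hb _)) ?_ ?_
  · have h2 : ∫ ω, (⨅ y : Y x, p.q x (y, E.scen x 0 ω)) ∂μ =
        ∫ ξ, (⨅ y : Y x, p.q x (y, ξ)) ∂p.F := by
      rw [← (hE.scen_law x 0).map_eq, integral_map (hae 0) hm.aestronglyMeasurable]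
    rw [h2] at h1
    exact h1
  · intro i j hij
    exact (hE.scen_indep.indepFun (i := (x, i)) (j := (x, j)) (by simpa using hij)).comp hm hm
  · intro j
    have h3 : IdentDistrib (E.scen x j) (E.scen x 0) μ μ :=
      ⟨hae j, hae 0, by rw [(hE.scen_law x j).map_eq, (hE.scen_law x 0).map_eq]⟩
    exact h3.comp hm

/-- A sandwich around the empirical mean of min_y q: the estimated gaps can lower the average by at
most the excess, the true gaps can raise it by at most c√α. These bounds are pathwise, so the
dependence of the solutions on all scenarios is harmless. -/
theorem IsRun.tendsto_average [TopologicalSpace Φ] [IsProbabilityMeasure μ] (hE : E.IsRun μ)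
    (hR : ∀ x φ, IsCorrelation (R x φ)) [IsProbabilityMeasure p.F] (x : X)
    (hmeas : ∀ y, Measurable fun ξ => p.q x (y, ξ)) {σ2 : ℝ} (hσ2 : 0 < σ2) {φ : Φ}
    (hbdd : ∃ C : ℝ, ∀ z, |p.q x z| ≤ C)
    (hrkhs : ∃ M : ℝ, ∀ᶠ φ' in 𝓝 φ, RKHSNormLE (R x φ') (p.q x) M)
    (hlocal : ∀ᵐ ω ∂μ, Tendsto (fun k => (E.sigma2 k x ω, E.phi k x ω))
      (atTop ⊓ 𝓟 {k | x ∈ E.D k ω}) (𝓝 (σ2, φ))) :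
    ∀ᵐ ω ∂μ, Tendsto (fun k => E.average k x ω) (atTop ⊓ 𝓟 {k | x ∈ E.D k ω}) (𝓝 (p.G x)) := by
  obtain ⟨c, hc, himp⟩ := hE.exists_improvement_le hR x hσ2 hbdd hrkhs
  have hpos : ∀ t, 0 < c * √(a.threshold t) := fun t =>
    mul_pos hc (Real.sqrt_pos.2 (a.threshold_pos t))
  have hsum : Summable fun t => c * √(a.threshold t) := a.summable_sqrt_threshold.mul_left c
  filter_upwards [hlocal, hE.tendsto_excess x hpos hsum, hE.tendsto_average_iInf x hmeas hbdd]
    with ω h1 h2 h3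
  have h4 := himp ω h1
  have hv := tendsto_visits E x ω
  have hN : Tendsto (fun k => E.N k x ω) (atTop ⊓ 𝓟 {k | x ∈ E.D k ω}) atTop :=
    a.tendsto_numScen.comp hv
  have h5 : Tendsto (fun k => c * √(a.threshold (E.visits k x ω)))
      (atTop ⊓ 𝓟 {k | x ∈ E.D k ω}) (𝓝 0) := hsum.tendsto_atTop_zero.comp hv
  have h6 := h3.comp hN
  have hNpos : ∀ᶠ k in atTop ⊓ 𝓟 {k | x ∈ E.D k ω}, 0 < E.N k x ω :=
    hN.eventually_gt_atTop 0
  have lower : Tendsto (fun k => p.c0 x + (∑ j ∈ Finset.range (E.N k x ω),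
      ⨅ y : Y x, p.q x (y, E.scen x j ω)) / (E.N k x ω : ℝ) -
      E.excess (c * √(a.threshold (E.visits k x ω))) x k (E.N k x ω) ω)
      (atTop ⊓ 𝓟 {k | x ∈ E.D k ω}) (𝓝 (p.G x)) := by
    have := (h6.const_add (p.c0 x)).sub h2
    simpa [Problem.G, Function.comp_def] using this
  have upper : Tendsto (fun k => p.c0 x + (∑ j ∈ Finset.range (E.N k x ω),
      ⨅ y : Y x, p.q x (y, E.scen x j ω)) / (E.N k x ω : ℝ) +
      c * √(a.threshold (E.visits k x ω)))
      (atTop ⊓ 𝓟 {k | x ∈ E.D k ω}) (𝓝 (p.G x)) := by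
    have := (h6.const_add (p.c0 x)).add h5
    simpa [Problem.G, Function.comp_def] using this
  have havg : ∀ k, 0 < E.N k x ω → E.average k x ω = p.c0 x +
      (∑ j ∈ Finset.range (E.N k x ω), p.q x (E.sol k x ω j, E.scen x j ω)) / (E.N k x ω : ℝ) -
      (1 / (E.N k x ω : ℝ)) * ∑ j ∈ Finset.range (E.N k x ω), E.gapEst k x j ω := by
    intro k hk
    have : (E.N k x ω : ℝ) ≠ 0 := by positivity
    simp only [average, output, Finset.sum_sub_distrib, Finset.sum_add_distrib, Finset.sum_const,
      Finset.card_range, nsmul_eq_mul]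
    field_simp
  refine tendsto_of_tendsto_of_tendsto_of_le_of_le' lower upper ?_ ?_
  · filter_upwards [h4, hNpos] with k hk hN0
    rw [havg k hN0]
    have e1 := average_gapEst_le (k := k) (x := x) (ω := ω) fun j hj y => (hk j hj y).1
    have e2 : (∑ j ∈ Finset.range (E.N k x ω), ⨅ y : Y x, p.q x (y, E.scen x j ω)) /
        (E.N k x ω : ℝ) ≤ (∑ j ∈ Finset.range (E.N k x ω),
          p.q x (E.sol k x ω j, E.scen x j ω)) / (E.N k x ω : ℝ) := by
      refine div_le_div_of_nonneg_right (Finset.sum_le_sum fun j _ => ?_) (by positivity)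
      exact ciInf_le (Set.finite_range _).bddBelow _
    linarith
  · filter_upwards [h4, hNpos] with k hk hN0
    rw [havg k hN0]
    have e1 : 0 ≤ (1 / (E.N k x ω : ℝ)) * ∑ j ∈ Finset.range (E.N k x ω), E.gapEst k x j ω :=
      mul_nonneg (by positivity) (Finset.sum_nonneg fun _ _ => gapEst_nonneg _ _ _ _)
    have e2 : (∑ j ∈ Finset.range (E.N k x ω), p.q x (E.sol k x ω j, E.scen x j ω)) /
        (E.N k x ω : ℝ) ≤ (∑ j ∈ Finset.range (E.N k x ω),
          ⨅ y : Y x, p.q x (y, E.scen x j ω)) / (E.N k x ω : ℝ) +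
          c * √(a.threshold (E.visits k x ω)) := by
      rw [div_add' _ _ _ (by positivity)]
      refine div_le_div_of_nonneg_right ?_ (by positivity)
      have e3 : c * √(a.threshold (E.visits k x ω)) * (E.N k x ω : ℝ) =
          ∑ _j ∈ Finset.range (E.N k x ω), c * √(a.threshold (E.visits k x ω)) := by
        rw [Finset.sum_const, Finset.card_range, nsmul_eq_mul, mul_comm]
      rw [e3, ← Finset.sum_add_distrib]
      refine Finset.sum_le_sum fun j hj => ?_
      obtain ⟨y, hy⟩ := exists_eq_ciInf_of_finite
        (f := fun y : Y x => p.q x (y, E.scen x j ω))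
      rw [← hy]
      linarith [(hk j (Finset.mem_range.1 hj) y).2]
    linarith

end

/-! ### Convergence of the current estimates -/

section

variable [∀ x, Fintype (Y x)]

theorem Gbar_of_mem {k : ℕ} {x : X} {ω : Ω} (h : x ∈ E.D k ω) :
    E.Gbar k x ω = E.average k x ω := by
  cases k <;> simp [Gbar, h]

theorem Gbar_succ_of_notMem {k : ℕ} {x : X} {ω : Ω} (h : x ∉ E.D (k + 1) ω) :
    E.Gbar (k + 1) x ω = E.Gbar k x ω := by simp [Gbar, h]

theorem tendsto_Gbar_of_frequently {x : X} {ω : Ω} {l : ℝ} (h : ∃ᶠ k in atTop, x ∈ E.D k ω)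
    (hl : Tendsto (fun k => E.average k x ω) (atTop ⊓ 𝓟 {k | x ∈ E.D k ω}) (𝓝 l)) :
    Tendsto (fun k => E.Gbar k x ω) atTop (𝓝 l) := by
  rw [Metric.tendsto_atTop]
  intro ε hε
  have h1 := eventually_inf_principal.1 (Metric.tendsto_nhds.1 hl ε hε)
  obtain ⟨K, hK⟩ := eventually_atTop.1 h1
  obtain ⟨k0, hk0, hx0⟩ := frequently_atTop.1 h K
  refine ⟨k0, fun k hk => ?_⟩
  induction k, hk using Nat.le_induction with
  | base => rw [Gbar_of_mem hx0]; exact hK k0 hk0 hx0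
  | succ k hk ih =>
    by_cases hx : x ∈ E.D (k + 1) ω
    · rw [Gbar_of_mem hx]; exact hK _ (by omega) hx
    · rw [Gbar_succ_of_notMem hx]; exact ih

/-- After a last visit the estimate is constant, otherwise it converges. Boundedness is thus
available without assuming infinitely many visits, whose proof relies on it. -/
theorem exists_abs_Gbar_le {x : X} {ω : Ω} {l : ℝ}
    (hl : Tendsto (fun k => E.average k x ω) (atTop ⊓ 𝓟 {k | x ∈ E.D k ω}) (𝓝 l)) :
    ∃ C, ∀ k, |E.Gbar k x ω| ≤ C := by
  have hconv : ∃ l', Tendsto (fun k => E.Gbar k x ω) atTop (𝓝 l') := by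
    by_cases h : ∃ᶠ k in atTop, x ∈ E.D k ω
    · exact ⟨l, tendsto_Gbar_of_frequently h hl⟩
    · obtain ⟨K, hK⟩ := eventually_atTop.1 (not_frequently.1 h)
      refine ⟨E.Gbar K x ω, tendsto_const_nhds.congr' ?_⟩
      filter_upwards [eventually_ge_atTop K] with k hk
      induction k, hk using Nat.le_induction with
      | base => rfl
      | succ k hk ih => rw [ih, Gbar_succ_of_notMem (hK _ (by omega))]
  obtain ⟨l', hl'⟩ := hconv
  obtain ⟨C, hC⟩ := (Metric.isBounded_range_of_tendsto _ hl').exists_norm_le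
  exact ⟨C, fun k => hC _ ⟨k, rfl⟩⟩

end

end Execution

/-! ### Bounds for the global metamodel -/

/-- The error splits into the covariance form at the vector `δ_z - u` and the noise carried by the
weights, so a lower eigenvalue bound applies to the first part. -/
theorem predError_eq_quadratic {Z : Type*} [Fintype Z] {k : Z → Z → ℝ}
    (hk : ∀ z z', k z z' = k z' z) (v : Z → ℝ) (P : Finset Z) (z : Z) (u : Z → ℝ)
    (hu : ∀ x, x ∉ P → u x = 0) :
    predError k v P z (fun i => u i) =
      ∑ x, ∑ x', ((Pi.single z 1 : Z → ℝ) x - u x) * ((Pi.single z 1 : Z → ℝ) x' - u x') * k x x' +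
        ∑ x ∈ P, u x ^ 2 * v x := by
  have ext : ∀ f : Z → ℝ, ∑ i : P, u i * f i = ∑ x, u x * f x := by
    intro f
    rw [Finset.sum_coe_sort P (fun x => u x * f x)]
    exact Finset.sum_subset (Finset.subset_univ _) fun x _ hx => by rw [hu x hx, zero_mul]
  have h1 : ∑ i : P, u i * k i z = ∑ x, u x * k x z := ext fun x => k x z
  have h2 : ∑ i : P, ∑ j : P, u i * u j * k i j = ∑ x, ∑ x', u x * u x' * k x x' := by
    have : ∀ i : P, ∑ j : P, u i * u j * k i j = u i * ∑ x', u x' * k i x' := by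
      intro i
      rw [← ext fun x' => k i x', Finset.mul_sum]
      exact Finset.sum_congr rfl fun j _ => by ring
    rw [Finset.sum_congr rfl fun i _ => this i, ext fun x => ∑ x', u x' * k x x']
    refine Finset.sum_congr rfl fun x _ => ?_
    rw [Finset.mul_sum]
    exact Finset.sum_congr rfl fun j _ => by ring
  rw [predError_eq, h1, h2, Finset.sum_coe_sort P (fun x => u x ^ 2 * v x)]
  congr 1
  have h3 : ∀ x x', ((Pi.single z 1 : Z → ℝ) x - u x) * ((Pi.single z 1 : Z → ℝ) x' - u x') *
      k x x' = (Pi.single z 1 : Z → ℝ) x * ((Pi.single z 1 : Z → ℝ) x' * k x x') -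
        (Pi.single z 1 : Z → ℝ) x * (u x' * k x x') -
        (Pi.single z 1 : Z → ℝ) x' * (u x * k x x') + u x * u x' * k x x' := by
    intro x x'; ring
  simp_rw [h3, Finset.sum_add_distrib, Finset.sum_sub_distrib]
  simp only [Pi.single_apply, ite_mul, one_mul, zero_mul, Finset.sum_ite_eq',
    Finset.mem_univ, if_true, Finset.sum_ite_irrel, Finset.sum_const_zero]
  simp_rw [hk z]
  ring

/-- If the covariance matrix is bounded and uniformly positive definite, then the prediction
weights are bounded, whatever the noise variances are, and the posterior variance is bounded away
from zero outside the design set. -/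
theorem exists_bounded_krigWeights {Z : Type*} [Fintype Z] {k : Z → Z → ℝ}
    (hk : ∀ z z', k z z' = k z' z) {v : Z → ℝ} (hv : ∀ z, 0 ≤ v z) {P : Finset Z}
    (hP : P.Nonempty) (hA : (krigMatrix k v P).PosDef) {l t : ℝ} (hl : 0 < l)
    (hlk : ∀ c : Z → ℝ, l * ∑ x, c x ^ 2 ≤ ∑ x, ∑ x', c x * c x' * k x x')
    (ht : ∀ x x', |k x x'| ≤ t) (z : Z) :
    ∃ u : Z → ℝ, (∀ f : Z → ℝ, krigMean k v P f z = ∑ x ∈ P, u x * f x) ∧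
      ∑ x ∈ P, u x ^ 2 ≤ 2 + 8 * t / l ∧ (z ∉ P → l ≤ krigCov k v P z z) := by
  obtain ⟨w, hsum, hmean, hcov, hmin⟩ := exists_krigWeights k v P hP hA z
  let u : Z → ℝ := fun x => if hx : x ∈ P then w ⟨x, hx⟩ else 0
  have huw : (fun i : P => u i) = w := by ext i; simp [u]
  have hu0 : ∀ x, x ∉ P → u x = 0 := fun x hx => by simp [u, hx]
  have ht0 : 0 ≤ t := (abs_nonneg _).trans (ht z z)
  have hquad := predError_eq_quadratic hk v P z u hu0
  rw [huw, ← hcov] at hquad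
  have hlow := hlk fun x => (Pi.single z 1 : Z → ℝ) x - u x
  have hd : ∑ x, ((Pi.single z 1 : Z → ℝ) x - u x) ^ 2 = 1 - 2 * u z + ∑ x ∈ P, u x ^ 2 := by
    have h1 : ∑ x ∈ P, u x ^ 2 = ∑ x, u x ^ 2 :=
      Finset.sum_subset (Finset.subset_univ _) fun x _ hx => by rw [hu0 x hx]; ring
    have h2 : ∀ x, ((Pi.single z 1 : Z → ℝ) x - u x) ^ 2 = (if x = z then 1 - 2 * u z else 0) +
        u x ^ 2 := by
      intro x
      by_cases hx : x = z
      · subst hx; simp; ring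
      · simp [hx]
    rw [h1]
    simp_rw [h2]
    rw [Finset.sum_add_distrib]; simp
  rw [hd] at hlow
  have hvn : 0 ≤ ∑ x ∈ P, u x ^ 2 * v x :=
    Finset.sum_nonneg fun x _ => mul_nonneg (sq_nonneg _) (hv x)
  have hn0 : 0 ≤ ∑ x ∈ P, u x ^ 2 := Finset.sum_nonneg fun x _ => sq_nonneg _
  refine ⟨u, fun f => ?_, ?_, fun hz => ?_⟩
  · rw [hmean, ← huw, Finset.sum_coe_sort P (fun x => u x * f x)]
  -- Competitor: all weight on a point of least noise. If the squared weights sum to at least one,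
  -- the optimal predictor carries at least that noise too, so it cancels and a bound free of `v`
  -- remains.
  · obtain ⟨i0, hi0, hvmin⟩ := P.exists_min_image v hP
    have h1 := hmin (Pi.single ⟨i0, hi0⟩ 1) (by simp)
    have h2 : predError k v P z (Pi.single ⟨i0, hi0⟩ 1) =
        k z z - 2 * k i0 z + k i0 i0 + v i0 := by
      rw [predError_eq]
      simp [Pi.single_apply]
    rw [h2] at h1
    have h3 : v i0 * ∑ x ∈ P, u x ^ 2 ≤ ∑ x ∈ P, u x ^ 2 * v x := by
      rw [Finset.mul_sum]
      refine Finset.sum_le_sum fun x hx => ?_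
      rw [mul_comm]
      exact mul_le_mul_of_nonneg_left (hvmin x hx) (sq_nonneg _)
    have h4 : k z z - 2 * k i0 z + k i0 i0 ≤ 4 * t := by
      have := abs_le.1 (ht z z); have := abs_le.1 (ht i0 z); have := abs_le.1 (ht i0 i0)
      linarith
    have h5 : u z ^ 2 ≤ ∑ x ∈ P, u x ^ 2 := by
      by_cases hz : z ∈ P
      · exact Finset.single_le_sum (f := fun x => u x ^ 2) (fun x _ => sq_nonneg _) hz
      · rw [hu0 z hz]; simpa using hn0
    set n := ∑ x ∈ P, u x ^ 2
    by_contra! hcon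
    have hn1 : 1 ≤ n := by
      have : 0 ≤ 8 * t / l := by positivity
      linarith
    have h6 : v i0 ≤ v i0 * n := le_mul_of_one_le_right (hv i0) hn1
    have h7 : l * (1 - 2 * u z + n) ≤ 4 * t := by linarith
    have h8 : n / 2 - 1 ≤ 1 - 2 * u z + n := by nlinarith [sq_nonneg (u z - 2)]
    have h9 : l * (n / 2 - 1) ≤ 4 * t := (mul_le_mul_of_nonneg_left h8 hl.le).trans h7
    have h10 : l * (2 + 8 * t / l) < l * n := mul_lt_mul_of_pos_left hcon hl
    have h11 : l * (2 + 8 * t / l) = 2 * l + 8 * t := by field_simp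
    linarith
  -- Outside the design the weight at `z` vanishes, so `δ_z - u` has norm at least one.
  · rw [hu0 z hz] at hlow
    nlinarith [mul_nonneg hl.le hn0]

/-- The minimum of the quadratic form over the compact unit sphere is positive; homogeneity extends
the bound to all vectors. -/
theorem IsCorrelation.exists_pos_le_quadratic {Z : Type*} [Fintype Z] {k : Z → Z → ℝ}
    (hk : IsCorrelation k) :
    ∃ l : ℝ, 0 < l ∧ ∀ c : Z → ℝ, l * ∑ x, c x ^ 2 ≤ ∑ x, ∑ x', c x * c x' * k x x' := by
  have hq : ∀ c : Z → ℝ, ∑ x, ∑ x', c x * c x' * k x x' = c ⬝ᵥ (Matrix.of k *ᵥ c) := by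
    intro c
    simp only [dotProduct, mulVec, Finset.mul_sum, Matrix.of_apply]
    exact Finset.sum_congr rfl fun i _ => Finset.sum_congr rfl fun j _ => by ring
  have hpos : ∀ c : Z → ℝ, c ≠ 0 → 0 < ∑ x, ∑ x', c x * c x' * k x x' := by
    intro c hc
    rw [hq]
    simpa using hk.2.dotProduct_mulVec_pos hc
  have hcont : Continuous fun c : Z → ℝ => ∑ x, ∑ x', c x * c x' * k x x' := by fun_prop
  by_cases hne : (Metric.sphere (0 : EuclideanSpace ℝ Z) 1).Nonempty
  · obtain ⟨c0, hc0, hmin⟩ := (isCompact_sphere (0 : EuclideanSpace ℝ Z) 1).exists_isMinOn hne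
      (f := fun c => ∑ x, ∑ x', c x * c x' * k x x')
      (by fun_prop)
    refine ⟨_, hpos c0 fun h => ?_, fun c => ?_⟩
    · have : c0 = 0 := by ext i; exact congrFun h i
      rw [this] at hc0
      simp at hc0
    · by_cases hc : c = 0
      · simp [hc]
      · have hc' : WithLp.toLp 2 c ≠ 0 := fun h => hc (by
          ext i; exact congrFun (congrArg WithLp.ofLp h) i)
        have hn : 0 < ‖WithLp.toLp 2 c‖ := norm_pos_iff.2 hc'
        have hmem : (‖WithLp.toLp 2 c‖)⁻¹ • WithLp.toLp 2 c ∈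
            Metric.sphere (0 : EuclideanSpace ℝ Z) 1 := by
          rw [mem_sphere_zero_iff_norm, norm_smul, norm_inv, norm_norm, inv_mul_cancel₀ hn.ne']
        have h1 := isMinOn_iff.1 hmin _ hmem
        have h2 : ∑ x, c x ^ 2 = ‖WithLp.toLp 2 c‖ ^ 2 := by
          rw [EuclideanSpace.norm_sq_eq]; simp
        simp only [PiLp.smul_apply, smul_eq_mul] at h1
        set ν := ‖WithLp.toLp 2 c‖
        have h3 : ∑ x, ∑ x', ν⁻¹ * c x * (ν⁻¹ * c x') * k x x' =
            (ν ^ 2)⁻¹ * ∑ x, ∑ x', c x * c x' * k x x' := by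
          simp only [Finset.mul_sum]
          refine Finset.sum_congr rfl fun i _ => Finset.sum_congr rfl fun j _ => ?_
          rw [sq, mul_inv]; ring
        rw [h3] at h1
        rw [h2, mul_comm]
        rwa [le_inv_mul_iff₀ (by positivity)] at h1
  · refine ⟨1, one_pos, fun c => ?_⟩
    have : IsEmpty Z := by
      by_contra h
      rw [not_isEmpty_iff] at h
      obtain ⟨z⟩ := h
      exact hne ⟨EuclideanSpace.single z 1, by simp⟩
    simp

theorem quadratic_le_of_abs_sub_le {Z : Type*} [Fintype Z] {k k' : Z → Z → ℝ} {l δ : ℝ}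
    (hl : ∀ c : Z → ℝ, l * ∑ x, c x ^ 2 ≤ ∑ x, ∑ x', c x * c x' * k x x')
    (hδ : ∀ x x', |k' x x' - k x x'| ≤ δ) (c : Z → ℝ) :
    (l - Fintype.card Z * δ) * ∑ x, c x ^ 2 ≤ ∑ x, ∑ x', c x * c x' * k' x x' := by
  have h1 : ∀ x x', c x * c x' * k x x' - δ * ((c x ^ 2 + c x' ^ 2) / 2) ≤
      c x * c x' * k' x x' := by
    intro x x'
    have h2 : |c x * c x' * (k' x x' - k x x')| ≤ (c x ^ 2 + c x' ^ 2) / 2 * δ := by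
      rw [abs_mul]
      refine mul_le_mul ?_ (hδ x x') (abs_nonneg _) (by positivity)
      rw [abs_le]
      constructor <;> nlinarith [sq_nonneg (c x - c x'), sq_nonneg (c x + c x')]
    have := (abs_le.1 h2).1
    nlinarith
  have h3 : ∑ x, ∑ x', (c x * c x' * k x x' - δ * ((c x ^ 2 + c x' ^ 2) / 2)) =
      ∑ x, ∑ x', c x * c x' * k x x' - Fintype.card Z * δ * ∑ x, c x ^ 2 := by
    simp only [Finset.sum_sub_distrib, ← Finset.mul_sum, ← Finset.sum_div, Finset.sum_add_distrib,
      Finset.sum_const, Finset.card_univ, nsmul_eq_mul]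
    ring
  have h4 := Finset.sum_le_sum fun x (_ : x ∈ Finset.univ) =>
    Finset.sum_le_sum fun x' (_ : x' ∈ (Finset.univ : Finset Z)) => h1 x x'
  rw [h3] at h4
  linarith [hl c]

/-- Probability that a normal variable lies below a point not much smaller than its mean. -/
theorem le_gaussianReal_Iio {m v g h s : ℝ} (hs : 0 < s) (hv : s ≤ v) (hh : 0 ≤ h)
    (hg : m - h ≤ g) :
    (gaussianReal 0 1).real (Set.Iio (-(h / √s))) ≤
      (gaussianReal m v.toNNReal).real (Set.Iio g) := by
  rw [gaussianReal_eq_map, map_measureReal_apply (by fun_prop) measurableSet_Iio]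
  refine measureReal_mono fun t ht => ?_
  have hs' : 0 < √s := Real.sqrt_pos.2 hs
  have hsv : √s ≤ √v := Real.sqrt_le_sqrt hv
  simp only [Set.mem_preimage, Set.mem_Iio] at ht ⊢
  have h1 : √v * t < √v * -(h / √s) := mul_lt_mul_of_pos_left ht (hs'.trans_le hsv)
  have h2 : h ≤ √v * (h / √s) := by
    rw [mul_div_assoc', le_div_iff₀ hs', mul_comm]
    exact mul_le_mul_of_nonneg_right hsv hh
  linarith

theorem gaussianReal_Iio_pos (t : ℝ) : 0 < (gaussianReal 0 1).real (Set.Iio t) := by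
  rw [measureReal_def, ENNReal.toReal_pos_iff]
  refine ⟨pos_iff_ne_zero.2 fun h => ?_, measure_lt_top _ _⟩
  have := gaussianReal_absolutelyContinuous' 0 one_ne_zero h
  simp at this

/-! ### Sampling probabilities and infinitely many visits -/

namespace Execution

variable {X : Type*} {Y : X → Type*} {Ξ : Type*} [MeasurableSpace Ξ]
  {p : Problem X Y Ξ} {a : Params} {Φ Ψ : Type*}
  {R : (x : X) → Φ → Y x × Ξ → Y x × Ξ → ℝ} {r : Ψ → X → X → ℝ}
  {Ω : Type*} [mΩ : MeasurableSpace Ω] [∀ x, Fintype (Y x)]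
  {E : Execution p a R r Ω} {μ : Measure Ω}

theorem bootVar_nonneg (k : ℕ) (x : X) (ω : Ω) : 0 ≤ E.bootVar k x ω := by
  have : (2 : ℝ) ≤ a.T := by exact_mod_cast a.two_le_T
  exact mul_nonneg (one_div_nonneg.2 (by linarith)) (Finset.sum_nonneg fun _ _ => sq_nonneg _)

theorem V_nonneg (k : ℕ) (x : X) (ω : Ω) : 0 ≤ E.V k x ω := by
  induction k with
  | zero => simp only [V]; split_ifs <;> [exact bootVar_nonneg _ _ _; exact le_rfl]
  | succ k ih => simp only [V]; split_ifs <;> [exact bootVar_nonneg _ _ _; exact ih]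

theorem improveProb_nonneg (k : ℕ) (x : X) (ω : Ω) : 0 ≤ E.improveProb k x ω :=
  measureReal_nonneg

theorem improveProb_le_one (k : ℕ) (x : X) (ω : Ω) : E.improveProb k x ω ≤ 1 :=
  measureReal_le_one

variable [Fintype X]

theorem IsRun.S_nonempty (hE : E.IsRun μ) (k : ℕ) (ω : Ω) : (E.S k ω).Nonempty := by
  obtain ⟨x, hx⟩ := hE.D_zero_nonempty ω
  exact ⟨x, Finset.mem_biUnion.2 ⟨0, by simp, hx⟩⟩

/-- Every first-stage point keeps a positive chance to be better than the current solution. -/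
theorem IsRun.exists_le_improveProb [TopologicalSpace Ψ] (hE : E.IsRun μ)
    (hr : ∀ ψ, IsCorrelation (r ψ)) {τ2 : ℝ} (hτ2 : 0 < τ2) {ψ : Ψ}
    (hrcont : ∀ x x', ContinuousAt (fun ψ' => r ψ' x x') ψ) {ω : Ω}
    (hglobal : Tendsto (fun k => (E.tau2 k ω, E.psi k ω)) atTop (𝓝 (τ2, ψ)))
    (hbdd : ∀ x, ∃ C, ∀ k, |E.Gbar k x ω| ≤ C) (x : X) :
    ∃ κ : ℝ, 0 < κ ∧ ∀ᶠ k in atTop, κ ≤ E.improveProb k x ω := by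
  choose C hC using hbdd
  set B := ∑ x, |C x|
  have hB : ∀ k x, |E.Gbar k x ω| ≤ B := fun k x =>
    (hC x k).trans ((le_abs_self _).trans
      (Finset.single_le_sum (f := fun x => |C x|) (fun _ _ => abs_nonneg _) (Finset.mem_univ x)))
  have hB0 : 0 ≤ B := Finset.sum_nonneg fun _ _ => abs_nonneg _
  rw [nhds_prod_eq] at hglobal
  have hτ : Tendsto (fun k => E.tau2 k ω) atTop (𝓝 τ2) := tendsto_fst.comp hglobal
  have hψ : Tendsto (fun k => E.psi k ω) atTop (𝓝 ψ) := tendsto_snd.comp hglobal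
  have hcov : ∀ x x', Tendsto (fun k => E.globCov k ω x x') atTop (𝓝 (τ2 * r ψ x x')) :=
    fun x x' => hτ.mul ((hrcont x x').tendsto.comp hψ)
  obtain ⟨l, hl, hlr⟩ := (hr ψ).exists_pos_le_quadratic
  have hlk : ∀ c : X → ℝ, τ2 * l * ∑ x, c x ^ 2 ≤ ∑ x, ∑ x', c x * c x' * (τ2 * r ψ x x') := by
    intro c
    have h1 : ∑ x, ∑ x', c x * c x' * (τ2 * r ψ x x') =
        τ2 * ∑ x, ∑ x', c x * c x' * r ψ x x' := by
      simp only [Finset.mul_sum]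
      exact Finset.sum_congr rfl fun i _ => Finset.sum_congr rfl fun j _ => by ring
    rw [h1, mul_assoc]
    exact mul_le_mul_of_nonneg_left (hlr c) hτ2.le
  have : Nonempty X := ⟨x⟩
  have hcard : (0 : ℝ) < Fintype.card X := by exact_mod_cast Fintype.card_pos
  -- An entrywise perturbation of this size costs at most half of the eigenvalue bound `τ2 * l`.
  set δ := τ2 * l / (2 * Fintype.card X) with hδ
  have hδ0 : 0 < δ := by positivity
  have hδl : τ2 * l - Fintype.card X * δ = τ2 * l / 2 := by rw [hδ]; field_simp; ring
  set T := ∑ x, ∑ x', |τ2 * r ψ x x'| + δ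
  set L := τ2 * l / 2 with hL
  have hL0 : 0 < L := by positivity
  -- Bound of the posterior mean, from |u G| ≤ (u² + G²)/2 and the bound on the sum of squared
  -- weights.
  set W := ((2 + 8 * T / L) + Fintype.card X * B ^ 2) / 2
  set s := min a.σmin2 L
  have hs : 0 < s := lt_min a.σmin2_pos hL0
  have hclose : ∀ᶠ k in atTop, ∀ x x', |E.globCov k ω x x' - τ2 * r ψ x x'| ≤ δ := by
    refine eventually_all.2 fun x => eventually_all.2 fun x' => ?_
    filter_upwards [Metric.tendsto_nhds.1 (hcov x x') δ hδ0] with k hk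
    exact hk.le
  have hT : ∀ x x', |τ2 * r ψ x x'| + δ ≤ T := by
    intro x x'
    refine add_le_add_left ?_ _
    exact (Finset.single_le_sum (f := fun x' => |τ2 * r ψ x x'|) (fun _ _ => abs_nonneg _)
      (Finset.mem_univ x')).trans (Finset.single_le_sum (f := fun x => ∑ x', |τ2 * r ψ x x'|)
        (fun _ _ => Finset.sum_nonneg fun _ _ => abs_nonneg _) (Finset.mem_univ x))
  have hT0 : 0 ≤ T := (by positivity : (0:ℝ) ≤ |τ2 * r ψ x x| + δ).trans (hT x x)
  have hW0 : 0 ≤ W := by positivity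
  refine ⟨_, gaussianReal_Iio_pos (-((B + W) / √s)), ?_⟩
  filter_upwards [hclose, hτ.eventually (lt_mem_nhds hτ2)] with k hk hτk
  have hquad := quadratic_le_of_abs_sub_le hlk hk
  rw [hδl] at hquad
  have hbound : ∀ x x', |E.globCov k ω x x'| ≤ T := by
    intro x x'
    refine le_trans ?_ (hT x x')
    have h1 := abs_add_le (E.globCov k ω x x' - τ2 * r ψ x x') (τ2 * r ψ x x')
    rw [sub_add_cancel] at h1
    linarith [hk x x']
  have hsymm : ∀ x x', E.globCov k ω x x' = E.globCov k ω x' x := fun x x' => by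
    simp only [globCov, (hr _).symm x x']
  obtain ⟨u, hmean, hu, hvar⟩ := exists_bounded_krigWeights hsymm
    (fun x' => V_nonneg (E := E) k x' ω) (hE.S_nonempty k ω)
    ((hr (E.psi k ω)).posDef_krigMatrix hτk (fun x' => V_nonneg (E := E) k x' ω) (E.S k ω))
    hL0 hquad hbound x
  have hpm : |E.postMean k x ω| ≤ W := by
    rw [postMean, hmean]
    calc _ ≤ ∑ y ∈ E.S k ω, |u y * E.Gbar k y ω| := Finset.abs_sum_le_sum_abs _ _
      _ ≤ ∑ y ∈ E.S k ω, (u y ^ 2 + B ^ 2) / 2 := by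
          refine Finset.sum_le_sum fun y _ => ?_
          have h1 : |E.Gbar k y ω| ^ 2 ≤ B ^ 2 := pow_le_pow_left₀ (abs_nonneg _) (hB k y) 2
          rw [abs_mul, ← sq_abs (u y)]
          nlinarith [sq_nonneg (|u y| - |E.Gbar k y ω|)]
      _ = (∑ y ∈ E.S k ω, u y ^ 2 + (E.S k ω).card * B ^ 2) / 2 := by
          rw [← Finset.sum_div, Finset.sum_add_distrib]; simp
      _ ≤ W := by
          have h1 : ((E.S k ω).card : ℝ) ≤ Fintype.card X := by
            exact_mod_cast Finset.card_le_univ _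
          have h2 := mul_le_mul_of_nonneg_right h1 (sq_nonneg B)
          simp only [W]
          linarith
  have hpv : s ≤ E.postVar k x ω := by
    rw [postVar]
    split_ifs with hx
    · exact (min_le_left _ _).trans (le_max_right _ _)
    · exact (min_le_right _ _).trans (hvar hx)
  refine le_gaussianReal_Iio hs hpv (by positivity) ?_
  have h1 := (abs_le.1 hpm).2
  have h2 := (abs_le.1 (hB k (E.xhat k ω))).1
  linarith

theorem le_sampling (k : ℕ) {x : X} {ω : Ω} (h : 0 < E.improveProb k x ω) :
    E.improveProb k x ω / Fintype.card X ≤ E.sampling k x ω := by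
  have h1 : E.improveProb k x ω ≤ ∑ x', E.improveProb k x' ω :=
    Finset.single_le_sum (f := fun x' => E.improveProb k x' ω)
      (fun _ _ => improveProb_nonneg _ _ _) (Finset.mem_univ x)
  have h2 : ∑ x', E.improveProb k x' ω ≤ Fintype.card X := by
    refine (Finset.sum_le_sum fun x' _ => improveProb_le_one k x' ω).trans ?_
    simp
  exact div_le_div_of_nonneg_left h.le (h.trans_le h1) h2

/-- Points with sampling probabilities bounded away from zero are visited infinitely often. -/
theorem IsRun.frequently_mem_D [IsProbabilityMeasure μ] (hE : E.IsRun μ) (x : X) :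
    ∀ᵐ ω ∂μ, (∃ κ : ℝ, 0 < κ ∧ ∀ᶠ k in atTop, κ ≤ E.sampling k x ω) →
      ∃ᶠ k in atTop, x ∈ E.D k ω := by
  -- All `s` draws hitting `x` is a smaller event than needed, but its conditional probability is
  -- read off from `draw_law` as a power of the sampling probability. The index is shifted since
  -- draw `k` is known only in the history of iteration `k + 1`.
  let s : ℕ → Set Ω := fun n => Nat.casesOn n ∅ fun k => {ω | ∀ i, E.draw k i ω = x}
  have hs : ∀ n, MeasurableSet[E.hist n] (s n) := by
    intro n
    cases n with
    | zero => exact @MeasurableSet.empty _ (E.hist 0)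
    | succ k =>
      refine hE.pre_le_hist (k + 1) _ ?_
      have : s (k + 1) = ⋂ i, {ω | E.draw k i ω = x} := by ext ω; simp [s]
      rw [this]
      exact MeasurableSet.iInter fun i => hE.draw_meas k i x
  have hlaw : ∀ᵐ ω ∂μ, ∀ k,
      (μ[(s (k + 1)).indicator (1 : Ω → ℝ) | E.hist k]) ω = E.sampling k x ω ^ a.s := by
    refine ae_all_iff.2 fun k => ?_
    filter_upwards [hE.draw_law k fun _ => x] with ω hω
    rw [Finset.prod_const, Finset.card_univ, Fintype.card_fin] at hω
    exact hω
  filter_upwards [ae_mem_limsup_atTop_iff μ hs, hlaw] with ω h1 h2 ⟨κ, hκ, h3⟩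
  have hnn : ∀ k, 0 ≤ E.sampling k x ω ^ a.s := fun k =>
    pow_nonneg (div_nonneg (improveProb_nonneg _ _ _)
      (Finset.sum_nonneg fun _ _ => improveProb_nonneg _ _ _)) _
  have h4 : Tendsto (fun n => ∑ k ∈ Finset.range n, E.sampling k x ω ^ a.s) atTop atTop := by
    rw [← not_summable_iff_tendsto_nat_atTop_of_nonneg hnn]
    intro hsum
    have h5 := hsum.tendsto_atTop_zero.eventually (gt_mem_nhds (pow_pos hκ a.s))
    obtain ⟨k, hk1, hk2⟩ := (h3.and h5).exists
    exact absurd (pow_le_pow_left₀ hκ.le hk1 a.s) (not_le.2 hk2)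
  simp only [h2] at h1
  have h6 := mem_limsup_iff_frequently_mem.1 (h1.2 h4)
  refine h6.mono fun n hn => ?_
  cases n with
  | zero => exact hn.elim
  | succ k =>
    rw [hE.D_succ]
    exact Finset.mem_image.2 ⟨⟨0, a.s_pos⟩, Finset.mem_univ _, hn _⟩

/-! ### Convergence of the optimal value -/

theorem IsRun.tendsto_Gbar_xhat (hE : E.IsRun μ) {ω : Ω} {G : X → ℝ} {xstar : X}
    (hxstar : ∀ x, G xstar ≤ G x) (hvis : ∃ᶠ k in atTop, xstar ∈ E.D k ω)
    (hG : ∀ x, Tendsto (fun k => E.Gbar k x ω) atTop (𝓝 (G x))) :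
    Tendsto (fun k => E.Gbar k (E.xhat k ω) ω) atTop (𝓝 (G xstar)) := by
  rw [Metric.tendsto_nhds]
  intro ε hε
  obtain ⟨k0, hk0⟩ := hvis.exists
  filter_upwards [eventually_all.2 fun x => Metric.tendsto_nhds.1 (hG x) ε hε,
    eventually_ge_atTop k0] with k h1 h2
  have hmem : xstar ∈ E.S k ω :=
    Finset.mem_biUnion.2 ⟨k0, Finset.mem_range.2 (Nat.lt_succ_iff.2 h2), hk0⟩
  have h3 := hE.xhat_min k ω xstar hmem
  have h4 := abs_lt.1 (h1 xstar)
  have h5 := abs_lt.1 (h1 (E.xhat k ω))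
  have h6 := hxstar (E.xhat k ω)
  exact abs_lt.2 ⟨by linarith, by linarith⟩

end Execution

end TwoStage

/-! ### Convergence of the reported optimal value -/

theorem theorem1 {X : Type*} [Fintype X] {Y : X → Type*} [∀ x, Fintype (Y x)]
    [∀ x, Nonempty (Y x)] {Ξ : Type*} [MeasurableSpace Ξ] {Φ Ψ : Type*} [TopologicalSpace Φ]
    [TopologicalSpace Ψ] {Ω : Type*} [MeasurableSpace Ω] (μ : Measure Ω) [IsProbabilityMeasure μ]
    -- the two-stage problem
    (p : TwoStage.Problem X Y Ξ) [IsProbabilityMeasure p.F]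
    (hmeas : ∀ x y, Measurable fun ξ => p.q x (y, ξ))
    -- correlation functions of the local and of the global metamodels
    (R : (x : X) → Φ → Y x × Ξ → Y x × Ξ → ℝ) (hR : ∀ x φ, TwoStage.IsCorrelation (R x φ))
    (r : Ψ → X → X → ℝ) (hr : ∀ ψ, TwoStage.IsCorrelation (r ψ))
    -- process parameters, with positive spatial variances
    (σ2 : X → ℝ) (hσ2 : ∀ x, 0 < σ2 x) (φ : X → Φ)
    (τ2 : ℝ) (hτ2 : 0 < τ2) (ψ : Ψ) (hrcont : ∀ x x', ContinuousAt (fun ψ' => r ψ' x x') ψ)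
    -- bounded response, bounded in the reproducing kernel Hilbert space norm
    (hbdd : ∃ C : ℝ, ∀ x y ξ, |p.c0 x + p.q x (y, ξ)| ≤ C)
    (hrkhs : ∃ M : ℝ, ∀ x, ∀ᶠ φ' in 𝓝 (φ x), TwoStage.RKHSNormLE (R x φ') (p.q x) M)
    -- a run of the algorithm
    (a : TwoStage.Params) (E : TwoStage.Execution p a R r Ω) (hE : E.IsRun μ)
    -- consistent parameter estimates, locally along the iterations that treat `x`, and globally
    (hlocal : ∀ᵐ ω ∂μ, ∀ x, Tendsto (fun k => (E.sigma2 k x ω, E.phi k x ω))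
      (atTop ⊓ 𝓟 {k | x ∈ E.D k ω}) (𝓝 (σ2 x, φ x)))
    (hglobal : ∀ᵐ ω ∂μ, Tendsto (fun k => (E.tau2 k ω, E.psi k ω)) atTop (𝓝 (τ2, ψ)))
    -- a true optimal solution
    (xstar : X) (hxstar : ∀ x, p.G xstar ≤ p.G x) :
    ∀ᵐ ω ∂μ,
      Tendsto (fun k => E.Gbar k (E.xhat k ω) ω) atTop (𝓝 (p.G xstar)) ∧
      Tendsto (fun C : ℝ => E.Gbar (E.stopIter C ω) (E.xhat (E.stopIter C ω) ω) ω) atTop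
        (𝓝 (p.G xstar)) := by
  have hq : ∀ x, ∃ C : ℝ, ∀ z, |p.q x z| ≤ C := by
    intro x
    obtain ⟨C, hC⟩ := hbdd
    refine ⟨C + |p.c0 x|, fun z => ?_⟩
    have h := abs_sub (p.c0 x + p.q x z) (p.c0 x)
    rw [add_sub_cancel_left] at h
    exact h.trans (add_le_add_left (hC x z.1 z.2) _)
  have havg : ∀ᵐ ω ∂μ, ∀ x, Tendsto (fun k => E.average k x ω)
      (atTop ⊓ 𝓟 {k | x ∈ E.D k ω}) (𝓝 (p.G x)) := by
    refine ae_all_iff.2 fun x => ?_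
    obtain ⟨M, hM⟩ := hrkhs
    exact hE.tendsto_average hR x (hmeas x) (hσ2 x) (hq x) ⟨M, hM x⟩
      (hlocal.mono fun ω h => h x)
  filter_upwards [havg, hglobal, ae_all_iff.2 hE.frequently_mem_D] with ω h1 h2 h3
  -- Only limits along visits have been used so far; infinitely many visits turn them into limits
  -- along all iterations.
  have hvis : ∀ x, ∃ᶠ k in atTop, x ∈ E.D k ω := by
    intro x
    obtain ⟨κ, hκ, h4⟩ := hE.exists_le_improveProb hr hτ2 hrcont h2
      (fun x => TwoStage.Execution.exists_abs_Gbar_le (h1 x)) x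
    have : Nonempty X := ⟨x⟩
    have hcard : (0 : ℝ) < Fintype.card X := by exact_mod_cast Fintype.card_pos
    refine h3 x ⟨κ / Fintype.card X, by positivity, ?_⟩
    filter_upwards [h4] with k hk
    exact (div_le_div_of_nonneg_right hk hcard.le).trans
      (TwoStage.Execution.le_sampling k (hκ.trans_le hk))
  have hlim := hE.tendsto_Gbar_xhat hxstar (hvis xstar) fun x =>
    TwoStage.Execution.tendsto_Gbar_of_frequently (hvis x) (h1 x)
  exact ⟨hlim, hlim.comp (TwoStage.Execution.tendsto_stopIter (hvis xstar))⟩
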